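/- Let $G$ be a finite group. A Hurwitz vector (of genus $0$) is an element $v=(v_1,\dots,v_d)$ of $\coprod_{d\ge 0}G^d$. The braid group $\mathrm{Br}_d$ acts on $G^d$ by $\sigma_i:(\dots,a,b,\dots)\mapsto(\dots,b,b^{-1}ab,\dots)$ (positions $i,i+1$), and $v\approx w$ means that $v,w$ have the same length and lie in one braid orbit. Juxtaposition makes $\mathcal H_G=\coprod_d G^d/\mathrm{Br}_d$ a monoid. The evaluation $ev(v)=v_1\cdots v_d\in G$, the Nielsen type $\nu(v)=\sum_{\mathcal C}\#\{j: v_j\in\mathcal C\}\,\mathcal C$ in the free abelian group on the conjugacy classes $\mathcal C$ of $G$ (ordered coefficientwise), and the generated subgroup $\langle v\rangle=\langle v_1,\dots,v_d\rangle$ depend only on the braid class $[v]_\approx$. For a union $\Gamma\subset G$ of conjugacy classes let $u_\Gamma$ be the Hurwitz vector in which each $g\in\Gamma$ is repeated $\mathrm{ord}(g)$ times. Its class is central in $\mathcal H_G$; put $\mathcal S_\Gamma=\{u_\Gamma^\ell:\ell\ge 0\}$, and extend $\nu$ to the monoid of fractions $\mathcal H_G\mathcal S_\Gamma^{-1}$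 by $\nu[v/u_\Gamma^\ell]=\nu(v)-\ell\,\nu(u_\Gamma)$. Let $F$ be the free group on symbols $\hat g$, $g\in G$, let $R=\ker(F\to G,\ \hat g\mapsto g)$, let $R_\Gamma$ be the normal closure in $F$ of $[F,R]$ and of all $\hat a\hat b\hat c^{-1}\hat b^{-1}$ with $a\in\Gamma$, $b\in G$, $c=b^{-1}ab$, let $G_\Gamma=F/R_\Gamma$, and let $H_{2,\Gamma}=\ker(G_\Gamma\to G\times G_\Gamma^{ab})$. Theorem. There is an integer $m=m(G)\ge 0$ such that the following holds for every union $\Gamma$ of conjugacy classes of $G$ for which (the entries of) $u_\Gamma$ generate $G$. The group $H_{2,\Gamma}$ is finite, and for every $\nu_0\in\nu(\coprod_d\Gamma^d)$ with $\nu_0\ge m\,\nu(u_\Gamma)$, writing $$X_{\nu_0}=\{[v]_\approx : \nu(v)=\nu_0,\ \langle v\rangle=G\},$$ 1. $\#X_{\nu_0}=\#H_{2,\Gamma}\cdot\#[G,G]$. 2. If $v_0$ is any Hurwitz vector with $\nu(v_0)=\nu_0$, then $ev$ maps $X_{\nu_0}$ into the coset $ev(v_0)[G,G]$, and for every $g$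 in this coset exactly $\#H_{2,\Gamma}$ elements of $X_{\nu_0}$ have evaluation $g$. 3. The kernel of $\nu:\mathcal H_G\mathcal S_\Gamma^{-1}\to\bigoplus_{\mathcal C}\mathbb Z\,\mathcal C$ acts on $X_{\nu_0}$ from the right, freely and transitively, in such a way that $[w]\cdot[v/u_\Gamma^\ell]=[w']$ if and only if $wv\approx w'u_\Gamma^\ell$. -/

import Mathlib

/-! ### Braid groups and the Hurwitz action -/

namespace HurwitzMonoid

/-- The relations of the Artin presentation of the braid group on `d` strands, with generators
`σ_0, …, σ_{d-2}`. -/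
def braidRels (d : ℕ) : Set (FreeGroup (Fin (d - 1))) :=
  {r | ∃ i j : Fin (d - 1), (i : ℕ) + 1 < j ∧
      r = FreeGroup.of i * FreeGroup.of j * (FreeGroup.of j * FreeGroup.of i)⁻¹} ∪
  {r | ∃ i j : Fin (d - 1), (i : ℕ) + 1 = j ∧
      r = FreeGroup.of i * FreeGroup.of j * FreeGroup.of i *
        (FreeGroup.of j * FreeGroup.of i * FreeGroup.of j)⁻¹}

/-- The Artin braid group `Br_d` on `d` strands (trivial for `d = 0, 1`). -/
abbrev BraidGroup (d : ℕ) : Type := PresentedGroup (braidRels d)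

variable {G : Type*} [Group G]

/-- The elementary Hurwitz move
`(…, a, b, …) ↦ (…, b, b⁻¹ a b, …)` at the positions `i, i + 1` (counted from `0`). -/
def move : ℕ → List G → List G
  | 0, a :: b :: l => b :: (b⁻¹ * a * b) :: l
  | n + 1, a :: l => a :: move n l
  | _, l => l

/-- The inverse elementary Hurwitz move
`(…, a, b, …) ↦ (…, a b a⁻¹, a, …)` at the positions `i, i + 1`. -/
def unmove : ℕ → List G → List G
  | 0, a :: b :: l => (a * b * a⁻¹) :: a :: l
  | n + 1, a :: l => a :: unmove n l
  | _, l => l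

theorem length_move (i : ℕ) (l : List G) : (move i l).length = l.length := by
  induction i generalizing l with
  | zero => rcases l with _ | ⟨a, _ | ⟨b, l⟩⟩ <;> simp [move]
  | succ n ih => rcases l with _ | ⟨a, l⟩ <;> simp [move, ih]

theorem length_unmove (i : ℕ) (l : List G) : (unmove i l).length = l.length := by
  induction i generalizing l with
  | zero => rcases l with _ | ⟨a, _ | ⟨b, l⟩⟩ <;> simp [unmove]
  | succ n ih => rcases l with _ | ⟨a, l⟩ <;> simp [unmove, ih]

theorem unmove_move (i : ℕ) (l : List G) : unmove i (move i l) = l := by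
  induction i generalizing l with
  | zero => rcases l with _ | ⟨a, _ | ⟨b, l⟩⟩ <;> simp [move, unmove, mul_assoc]
  | succ n ih => rcases l with _ | ⟨a, l⟩ <;> simp [move, unmove, ih]

theorem move_unmove (i : ℕ) (l : List G) : move i (unmove i l) = l := by
  induction i generalizing l with
  | zero => rcases l with _ | ⟨a, _ | ⟨b, l⟩⟩ <;> simp [move, unmove, mul_assoc]
  | succ n ih => rcases l with _ | ⟨a, l⟩ <;> simp [move, unmove, ih]

theorem move_comm (i j : ℕ) (h : i + 1 < j) (l : List G) :
    move i (move j l) = move j (move i l) := by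
  induction i generalizing j l with
  | zero =>
    obtain ⟨k, rfl⟩ : ∃ k, j = k + 2 := ⟨j - 2, by omega⟩
    rcases l with _ | ⟨a, _ | ⟨b, l⟩⟩ <;> simp [move]
  | succ n ih =>
    obtain ⟨k, rfl⟩ : ∃ k, j = k + 1 := ⟨j - 1, by omega⟩
    rcases l with _ | ⟨a, l⟩
    · simp [move]
    · simp [move, ih k (by omega)]

theorem move_braid (i : ℕ) (l : List G) (h : i + 2 < l.length) :
    move i (move (i + 1) (move i l)) = move (i + 1) (move i (move (i + 1) l)) := by
  induction i generalizing l with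
  | zero =>
    rcases l with _ | ⟨a, _ | ⟨b, _ | ⟨c, l⟩⟩⟩ <;> simp [move, mul_assoc] at h ⊢
  | succ n ih =>
    rcases l with _ | ⟨a, l⟩
    · simp at h
    · simpa [move] using ih l (by simp only [List.length_cons] at h; omega)

/-- The set `G^d`, as the set of lists of length `d`. -/
abbrev Tuple (G : Type*) (d : ℕ) : Type _ := {l : List G // l.length = d}

/-- The elementary Hurwitz move as a permutation of `G^d`. -/
def movePerm (d i : ℕ) : Equiv.Perm (Tuple G d) where
  toFun v := ⟨move i v.1, (length_move i v.1).trans v.2⟩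
  invFun v := ⟨unmove i v.1, (length_unmove i v.1).trans v.2⟩
  left_inv v := Subtype.ext (unmove_move i v.1)
  right_inv v := Subtype.ext (move_unmove i v.1)

theorem movePerm_rels (d : ℕ) : ∀ r ∈ braidRels d,
    FreeGroup.lift (fun i : Fin (d - 1) => movePerm (G := G) d i) r = 1 := by
  rintro r (⟨i, j, h, rfl⟩ | ⟨i, j, h, rfl⟩)
  · rw [map_mul, map_inv, mul_inv_eq_one]
    ext1 v
    simpa [movePerm] using move_comm (i : ℕ) j h v.1
  · rw [map_mul, map_inv, mul_inv_eq_one]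
    ext1 v
    have := move_braid (i : ℕ) v.1 (by have := j.2; have := v.2; omega)
    rw [h] at this
    simpa [movePerm] using this

/-- The Hurwitz action of `Br_d` on `G^d`. -/
def hurwitzHom (G : Type*) [Group G] (d : ℕ) : BraidGroup d →* Equiv.Perm (Tuple G d) :=
  PresentedGroup.toGroup (movePerm_rels d)

instance hurwitzAction (d : ℕ) : MulAction (BraidGroup d) (Tuple G d) :=
  MulAction.compHom _ (hurwitzHom G d)

/-- Hurwitz vectors of genus `0`, i.e. elements of the disjoint union of the `G^d`, `d ≥ 0`,
a monoid under juxtaposition. -/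
abbrev HurwitzVector (G : Type*) : Type _ := FreeMonoid G

/-- Braid equivalence: two Hurwitz vectors are equivalent if they have the same length `d`
and lie in the same orbit of the braid group `Br_d`. -/
def BraidEquiv (v w : HurwitzVector G) : Prop :=
  ∃ (d : ℕ) (hv : v.toList.length = d) (hw : w.toList.length = d),
    (⟨w.toList, hw⟩ : Tuple G d) ∈
      MulAction.orbit (BraidGroup d) (⟨v.toList, hv⟩ : Tuple G d)

/-- One elementary Hurwitz move. -/
def Step (v w : List G) : Prop := ∃ i : ℕ, i + 1 < v.length ∧ w = move i v

theorem braidEquiv_iff (v w : HurwitzVector G) :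
    BraidEquiv v w ↔ Relation.EqvGen Step v.toList w.toList := by
  constructor
  · rintro ⟨d, hv, hw, β, hβ⟩
    have key : ∀ (β : BraidGroup d) (x : Tuple G d), Relation.EqvGen Step x.1 (β • x).1 := by
      intro β
      have hβ' : β ∈ Subgroup.closure (Set.range (PresentedGroup.of (rels := braidRels d))) := by
        rw [PresentedGroup.closure_range_of]; trivial
      induction hβ' using Subgroup.closure_induction with
      | mem y hy =>
        obtain ⟨i, rfl⟩ := hy
        intro x
        refine .rel _ _ ⟨i, by have := i.2; have := x.2; omega, ?_⟩
        change (hurwitzHom G d (PresentedGroup.of i) x).1 = _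
        rw [hurwitzHom, PresentedGroup.toGroup.of]
        rfl
      | one => intro x; rw [one_smul]; exact .refl _
      | mul y z _ _ hy hz =>
        intro x
        rw [mul_smul]
        exact (hz x).trans _ _ _ (hy _)
      | inv y _ hy =>
        intro x
        have := hy (y⁻¹ • x)
        rw [smul_inv_smul] at this
        exact this.symm
    have := key β ⟨v.toList, hv⟩
    change β • (⟨v.toList, hv⟩ : Tuple G d) = _ at hβ
    rwa [hβ] at this
  · intro h
    have key : ∀ x y : List G, Relation.EqvGen Step x y →
        ∃ (d : ℕ) (hx : x.length = d) (hy : y.length = d),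
        (⟨y, hy⟩ : Tuple G d) ∈
          MulAction.orbit (BraidGroup d) (⟨x, hx⟩ : Tuple G d) := by
      intro x y h
      induction h with
      | rel x y h =>
        obtain ⟨i, hi, rfl⟩ := h
        refine ⟨_, rfl, length_move i x, PresentedGroup.of ⟨i, by omega⟩, ?_⟩
        change (hurwitzHom G x.length (PresentedGroup.of ⟨i, by omega⟩) ⟨x, rfl⟩) = _
        rw [hurwitzHom, PresentedGroup.toGroup.of]
        rfl
      | refl x => exact ⟨_, rfl, rfl, MulAction.mem_orbit_self _⟩
      | symm x y _ ih =>
        obtain ⟨d, hx, hy, ih⟩ := ih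
        exact ⟨d, hy, hx, MulAction.mem_orbit_symm.1 ih⟩
      | trans x y z _ _ ih₁ ih₂ =>
        obtain ⟨d, hx, hy, ih₁⟩ := ih₁
        obtain ⟨e, hy', hz, ih₂⟩ := ih₂
        obtain rfl : d = e := hy.symm.trans hy'
        refine ⟨d, hx, hz, ?_⟩
        rw [← MulAction.orbit_eq_iff.2 ih₁]
        exact ih₂
    exact key _ _ h

theorem move_append (i : ℕ) (v w : List G) (h : i + 1 < v.length) :
    move i (v ++ w) = move i v ++ w := by
  induction i generalizing v with
  | zero => rcases v with _ | ⟨a, _ | ⟨b, v⟩⟩ <;> simp [move] at h ⊢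
  | succ n ih =>
    rcases v with _ | ⟨a, v⟩
    · simp at h
    · simpa [move] using ih v (by simpa using h)

theorem move_append_right (i : ℕ) (v w : List G) :
    move (v.length + i) (v ++ w) = v ++ move i w := by
  induction v with
  | nil => simp
  | cons a v ih =>
    rw [List.length_cons, Nat.add_right_comm]
    simpa [move] using ih

theorem eqvGen_append_right {v v' : List G} (w : List G) (h : Relation.EqvGen Step v v') :
    Relation.EqvGen Step (v ++ w) (v' ++ w) := by
  induction h with
  | rel x y h =>
    obtain ⟨i, hi, rfl⟩ := h
    exact .rel _ _ ⟨i, by rw [List.length_append]; omega, (move_append i x w hi).symm⟩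
  | refl x => exact .refl _
  | symm x y _ ih => exact ih.symm
  | trans x y z _ _ h₁ h₂ => exact h₁.trans _ _ _ h₂

theorem eqvGen_append_left (v : List G) {w w' : List G} (h : Relation.EqvGen Step w w') :
    Relation.EqvGen Step (v ++ w) (v ++ w') := by
  induction h with
  | rel x y h =>
    obtain ⟨i, hi, rfl⟩ := h
    exact .rel _ _ ⟨v.length + i, by rw [List.length_append]; omega,
      (move_append_right i v x).symm⟩
  | refl x => exact .refl _
  | symm x y _ ih => exact ih.symm
  | trans x y z _ _ h₁ h₂ => exact h₁.trans _ _ _ h₂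

/-- Braid equivalence is a congruence for juxtaposition. -/
def braidCon (G : Type*) [Group G] : Con (HurwitzVector G) where
  r := BraidEquiv
  iseqv :=
    { refl := fun v => (braidEquiv_iff v v).2 (.refl _)
      symm := fun {v w} h => (braidEquiv_iff w v).2 ((braidEquiv_iff v w).1 h).symm
      trans := fun {u v w} h₁ h₂ => (braidEquiv_iff u w).2
        (((braidEquiv_iff u v).1 h₁).trans _ _ _ ((braidEquiv_iff v w).1 h₂)) }
  mul' := fun {v v' w w'} h₁ h₂ => (braidEquiv_iff _ _).2
    ((eqvGen_append_right w.toList ((braidEquiv_iff v v').1 h₁)).trans _ _ _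
      (eqvGen_append_left v'.toList ((braidEquiv_iff w w').1 h₂)))

/-- The Hurwitz class monoid `ℋ_G`: the disjoint union of the `G^d / Br_d`, with juxtaposition. -/
abbrev HClass (G : Type*) [Group G] : Type _ := (braidCon G).Quotient

/-- The braid class of a Hurwitz vector. -/
def cls : HurwitzVector G →* HClass G := (braidCon G).mk'

/-! ### Evaluation, Nielsen type, generated subgroup -/

/-- The evaluation `(v_1, …, v_d) ↦ v_1 ⋯ v_d`. -/
def evalVec (G : Type*) [Group G] : HurwitzVector G →* G := FreeMonoid.lift id

/-- The free abelian group on the conjugacy classes of `G`, with its coordinatewise order. -/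
abbrev NielsenGroup (G : Type*) [Group G] : Type _ := ConjClasses G →₀ ℤ

/-- The Nielsen map on Hurwitz vectors, as a homomorphism (the target is written
multiplicatively). -/
noncomputable def nielsenHomVec (G : Type*) [Group G] :
    HurwitzVector G →* Multiplicative (NielsenGroup G) :=
  FreeMonoid.lift fun g => Multiplicative.ofAdd (Finsupp.single (ConjClasses.mk g) 1)

/-- The Nielsen type of a Hurwitz vector. -/
noncomputable def nielsenVec (v : HurwitzVector G) : NielsenGroup G :=
  Multiplicative.toAdd (nielsenHomVec G v)

open Classical in
/-- The coefficient of the Nielsen type at a conjugacy class `C` is the number of entries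
in `C`. -/
theorem nielsenVec_apply (v : HurwitzVector G) (C : ConjClasses G) :
    nielsenVec v C = (v.toList.countP fun g => ConjClasses.mk g = C : ℕ) := by
  induction v using FreeMonoid.inductionOn' with
  | one => simp [nielsenVec]
  | of_mul g v ih =>
    have : nielsenVec (FreeMonoid.of g * v) =
        Finsupp.single (ConjClasses.mk g) 1 + nielsenVec v := by
      simp [nielsenVec, nielsenHomVec]
    rw [this, Finsupp.add_apply, ih]
    simp only [FreeMonoid.toList_mul, FreeMonoid.toList_of, List.singleton_append,
      List.countP_cons, Finsupp.single_apply, decide_eq_true_eq]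
    split_ifs <;> push_cast <;> ring

/-- The subgroup generated by the entries of a Hurwitz vector. -/
def genVec (v : HurwitzVector G) : Subgroup G := Subgroup.closure {g | g ∈ v.toList}

theorem evalVec_cons (a : G) (l : List G) :
    evalVec G (FreeMonoid.ofList (a :: l)) = a * evalVec G (FreeMonoid.ofList l) := by
  rw [FreeMonoid.ofList_cons, map_mul]
  simp [evalVec]

theorem nielsenHomVec_cons (a : G) (l : List G) :
    nielsenHomVec G (FreeMonoid.ofList (a :: l)) =
      Multiplicative.ofAdd (Finsupp.single (ConjClasses.mk a) 1) *
        nielsenHomVec G (FreeMonoid.ofList l) := by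
  rw [FreeMonoid.ofList_cons, map_mul]
  simp [nielsenHomVec]

theorem mk_conj (a b : G) : ConjClasses.mk (b⁻¹ * a * b) = ConjClasses.mk a :=
  ConjClasses.mk_eq_mk_iff_isConj.2 (isConj_iff.2 ⟨b, by group⟩)

theorem evalVec_move (i : ℕ) (l : List G) :
    evalVec G (FreeMonoid.ofList (move i l)) = evalVec G (FreeMonoid.ofList l) := by
  induction i generalizing l with
  | zero =>
    rcases l with _ | ⟨a, _ | ⟨b, l⟩⟩ 
    · rfl
    · rfl
    · simp only [move, evalVec_cons]; group
  | succ n ih =>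
    rcases l with _ | ⟨a, l⟩
    · rfl
    · simp only [move, evalVec_cons, ih]

theorem nielsenHomVec_move (i : ℕ) (l : List G) :
    nielsenHomVec G (FreeMonoid.ofList (move i l)) = nielsenHomVec G (FreeMonoid.ofList l) := by
  induction i generalizing l with
  | zero =>
    rcases l with _ | ⟨a, _ | ⟨b, l⟩⟩
    · rfl
    · rfl
    · simp only [move, nielsenHomVec_cons, mk_conj]
      exact mul_left_comm _ _ _
  | succ n ih =>
    rcases l with _ | ⟨a, l⟩
    · rfl
    · simp only [move, nielsenHomVec_cons, ih]

theorem closure_cons (a : G) (l : List G) :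
    Subgroup.closure {g | g ∈ a :: l} = Subgroup.closure {a} ⊔ Subgroup.closure {g | g ∈ l} := by
  rw [← Subgroup.closure_union]
  congr 1
  ext g
  simp

theorem closure_move (i : ℕ) (l : List G) :
    Subgroup.closure {g | g ∈ move i l} = Subgroup.closure {g | g ∈ l} := by
  induction i generalizing l with
  | zero =>
    rcases l with _ | ⟨a, _ | ⟨b, l⟩⟩
    · rfl
    · rfl
    · simp only [move, closure_cons, ← sup_assoc]
      congr 1
      rw [← Subgroup.closure_union, ← Subgroup.closure_union]
      apply le_antisymm
      · rw [Subgroup.closure_le]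
        have ha : a ∈ Subgroup.closure ({a} ∪ {b}) := Subgroup.subset_closure (by simp)
        have hb : b ∈ Subgroup.closure ({a} ∪ {b}) := Subgroup.subset_closure (by simp)
        rintro x (rfl | rfl)
        · exact hb
        · exact mul_mem (mul_mem (inv_mem hb) ha) hb
      · rw [Subgroup.closure_le]
        have hb : b ∈ Subgroup.closure ({b} ∪ {b⁻¹ * a * b}) :=
          Subgroup.subset_closure (by simp)
        have ha : b⁻¹ * a * b ∈ Subgroup.closure ({b} ∪ {b⁻¹ * a * b}) :=
          Subgroup.subset_closure (by simp)
        rintro x (rfl | rfl)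
        · simpa [mul_assoc] using mul_mem (mul_mem hb ha) (inv_mem hb)
        · exact hb
  | succ n ih =>
    rcases l with _ | ⟨a, l⟩
    · rfl
    · simp only [move, closure_cons, ih]

theorem eq_of_braidEquiv {α : Type*} (f : List G → α) (hf : ∀ i l, f (move i l) = f l)
    {v w : HurwitzVector G} (h : BraidEquiv v w) : f v.toList = f w.toList := by
  have key : ∀ x y : List G, Relation.EqvGen Step x y → f x = f y := by
    intro x y h
    induction h with
    | rel x y h => obtain ⟨i, _, rfl⟩ := h; exact (hf i x).symm
    | refl x => rfl
    | symm x y _ ih => exact ih.symm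
    | trans x y z _ _ h₁ h₂ => exact h₁.trans h₂
  exact key _ _ ((braidEquiv_iff v w).1 h)

/-- The evaluation on the Hurwitz class monoid. -/
def ev (G : Type*) [Group G] : HClass G →* G :=
  (braidCon G).lift (evalVec G) fun _ _ h =>
    eq_of_braidEquiv (fun l => evalVec G (FreeMonoid.ofList l)) evalVec_move h

/-- The Nielsen map on the Hurwitz class monoid, as a homomorphism. -/
noncomputable def nielsenHom (G : Type*) [Group G] :
    HClass G →* Multiplicative (NielsenGroup G) :=
  (braidCon G).lift (nielsenHomVec G) fun _ _ h =>
    eq_of_braidEquiv (fun l => nielsenHomVec G (FreeMonoid.ofList l)) nielsenHomVec_move h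

/-- The Nielsen type of a braid class. -/
noncomputable def nielsen (x : HClass G) : NielsenGroup G :=
  Multiplicative.toAdd (nielsenHom G x)

/-- The subgroup of `G` generated by (the entries of any representative of) a braid class. -/
def gen (x : HClass G) : Subgroup G :=
  Quotient.lift (s := (braidCon G).toSetoid) genVec
    (fun _ _ h => eq_of_braidEquiv (fun l => Subgroup.closure {g | g ∈ l}) closure_move h) x

theorem ev_cls (v : HurwitzVector G) : ev G (cls v) = evalVec G v := rfl

theorem nielsen_cls (v : HurwitzVector G) : nielsen (cls v) = nielsenVec v := rfl

theorem gen_cls (v : HurwitzVector G) : gen (cls v) = genVec v := rfl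

/-! ### The vector `u_Γ` and the localisation -/

/-- The Hurwitz vector `u_Γ`, in which each element `g` of `Γ` occurs `ord g` times in a row, for
some enumeration of `Γ`. -/
noncomputable def uVec [Finite G] (Γ : Set G) : HurwitzVector G :=
  FreeMonoid.ofList <|
    (Set.toFinite Γ).toFinset.toList.flatMap fun g => List.replicate (orderOf g) g

/-- The braid class of `u_Γ`. -/
noncomputable def uCls [Finite G] (Γ : Set G) : HClass G := cls (uVec Γ)

theorem cls_of_mul_of (a b : G) :
    cls (FreeMonoid.of a) * cls (FreeMonoid.of b) =
      cls (FreeMonoid.of b) * cls (FreeMonoid.of (b⁻¹ * a * b)) := by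
  rw [← map_mul, ← map_mul]
  refine (braidCon G).eq.2 ((braidEquiv_iff _ _).2 (.rel _ _ ⟨0, ?_, ?_⟩))
  · simp
  · simp [move]

theorem cls_of_mul (a : G) (v : HurwitzVector G) :
    cls (FreeMonoid.of a) * cls v =
      cls v * cls (FreeMonoid.of ((evalVec G v)⁻¹ * a * evalVec G v)) := by
  induction v using FreeMonoid.inductionOn' generalizing a with
  | one => simp
  | of_mul g v ih =>
    rw [map_mul, ← mul_assoc, cls_of_mul_of, mul_assoc, ih, ← mul_assoc, map_mul]
    have : evalVec G (FreeMonoid.of g) = g := by simp [evalVec]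
    rw [this]
    congr 3
    group

/-- A Hurwitz vector with trivial evaluation is central in the Hurwitz class monoid. -/
theorem cls_central (v : HurwitzVector G) (hv : evalVec G v = 1) (w : HClass G) :
    w * cls v = cls v * w := by
  obtain ⟨w, rfl⟩ : ∃ w', cls w' = w := (braidCon G).mk'_surjective w
  induction w using FreeMonoid.inductionOn' with
  | one => simp
  | of_mul g w ih =>
    rw [map_mul, mul_assoc, ih, ← mul_assoc, cls_of_mul, hv, mul_assoc]
    simp

theorem evalVec_uVec [Finite G] (Γ : Set G) : evalVec G (uVec Γ) = 1 := by
  unfold uVec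
  generalize (Set.toFinite Γ).toFinset.toList = l
  induction l with
  | nil => simp
  | cons a l ih =>
    rw [List.flatMap_cons, FreeMonoid.ofList_append, map_mul, ih, mul_one]
    simp [evalVec, FreeMonoid.lift_apply, pow_orderOf_eq_one]

/-- The denominator set `𝒮_Γ` generated by `u_Γ`. -/
noncomputable abbrev denom [Finite G] (Γ : Set G) : Submonoid (HClass G) :=
  Submonoid.powers (uCls Γ)

theorem denom_central [Finite G] (Γ : Set G) (s : denom Γ) (x : HClass G) :
    x * (s : HClass G) = s * x := by
  obtain ⟨_, n, rfl⟩ := s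
  have : Commute x (uCls Γ) := cls_central _ (evalVec_uVec Γ) x
  exact this.pow_right n

/-- As `𝒮_Γ` is central, fractions with denominators in `𝒮_Γ` can be formed. -/
noncomputable instance oreSetDenom [Finite G] (Γ : Set G) : OreLocalization.OreSet (denom Γ) where
  ore_right_cancel r₁ r₂ s h := ⟨s, by rw [← denom_central, ← denom_central, h]⟩
  oreNum r _ := r
  oreDenom _ s := s
  ore_eq r s := (denom_central Γ s r).symm

/-- The monoid of fractions `ℋ_G 𝒮_Γ⁻¹`. -/
abbrev Loc [Finite G] (Γ : Set G) : Type _ := OreLocalization (denom Γ) (HClass G)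

/-- The fraction `[v / u_Γ^ℓ]`. -/
noncomputable def frac [Finite G] (Γ : Set G) (v : HClass G) (l : ℕ) : Loc Γ :=
  OreLocalization.oreDiv v ⟨uCls Γ ^ l, l, rfl⟩

/-- The extension of the Nielsen map to the monoid of fractions. -/
noncomputable def nielsenLoc [Finite G] (Γ : Set G) :
    Loc Γ →* Multiplicative (NielsenGroup G) :=
  OreLocalization.universalMulHom (nielsenHom G)
    (toUnits.toMonoidHom.comp ((nielsenHom G).comp (denom Γ).subtype)) fun _ => rfl

theorem nielsenLoc_frac [Finite G] (Γ : Set G) (v : HClass G) (l : ℕ) :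
    Multiplicative.toAdd (nielsenLoc Γ (frac Γ v l)) = nielsen v - l • nielsen (uCls Γ) := by
  have : nielsenLoc Γ (frac Γ v l) = (nielsenHom G (uCls Γ ^ l))⁻¹ * nielsenHom G v := rfl
  rw [this, map_pow, sub_eq_neg_add]
  rfl

/-- The kernel of the Nielsen map on the monoid of fractions. -/
noncomputable abbrev nielsenKer [Finite G] (Γ : Set G) : Submonoid (Loc Γ) :=
  MonoidHom.mker (nielsenLoc Γ)

/-- The set of braid classes of Hurwitz vectors of given Nielsen type that generate `G`. -/
def genClasses (ν₀ : NielsenGroup G) : Set (HClass G) :=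
  {x | nielsen x = ν₀ ∧ gen x = ⊤}

/-! ### The group `H_{2,Γ}` -/

/-- The projection `F_G → G`, `ĝ ↦ g`, from the free group on the set `G`. -/
def freeProj (G : Type*) [Group G] : FreeGroup G →* G := FreeGroup.lift id

/-- The normal subgroup `R_Γ` of `F_G`, normally generated by `[F, R]`, where `R` is the kernel of
`F_G → G`, and by the elements `â b̂ ĉ⁻¹ b̂⁻¹` with `a ∈ Γ`, `b ∈ G`, `c = b⁻¹ a b`. -/
def relSubgroup (Γ : Set G) : Subgroup (FreeGroup G) :=
  Subgroup.normalClosure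
    ((⁅(⊤ : Subgroup (FreeGroup G)), (freeProj G).ker⁆ : Subgroup (FreeGroup G)) ∪
      {r | ∃ a ∈ Γ, ∃ b : G, r = FreeGroup.of a * FreeGroup.of b *
        (FreeGroup.of (b⁻¹ * a * b))⁻¹ * (FreeGroup.of b)⁻¹})

instance relSubgroup_normal (Γ : Set G) : (relSubgroup Γ).Normal :=
  Subgroup.normalClosure_normal

/-- The group `G_Γ = F / R_Γ`. -/
abbrev TautGroup (Γ : Set G) : Type _ := FreeGroup G ⧸ relSubgroup Γ

theorem relSubgroup_le (Γ : Set G) : relSubgroup Γ ≤ (freeProj G).ker := by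
  refine Subgroup.normalClosure_le_normal ?_
  rintro r (h | ⟨a, _, b, rfl⟩)
  · exact Subgroup.commutator_le_right _ _ h
  · simp [freeProj, mul_assoc]

/-- The boundary homomorphism `α : G_Γ → G`, induced by `ĝ ↦ g`. -/
def boundary (Γ : Set G) : TautGroup Γ →* G :=
  QuotientGroup.lift (relSubgroup Γ) (freeProj G) (relSubgroup_le Γ)

/-- `H_{2,Γ}(G)`, the kernel of `G_Γ → G × G_Γ^{ab}`. -/
def H2 (Γ : Set G) : Subgroup (TautGroup Γ) :=
  ((boundary Γ).prod (Abelianization.of : TautGroup Γ →* Abelianization (TautGroup Γ))).ker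

end HurwitzMonoid

open HurwitzMonoid

/-! The argument is of Conway–Parker type. Multiplication by a letter of `Γ` is eventually bijective
on generating classes, so these classes become fractions, and the fractions of a fixed Nielsen type
form a torsor under the commutator subgroup of `G_Γ`.

Stabilisation (`exists_single_mul_of_mem_genClasses`): let `v` generate `G` and have type `ν + [g]`
with `ν ≥ ν(u_Γ)`. By pigeonhole some conjugate `h` of `g` occurs more than `ord h` times in `v`.
Split off `h^(ord h)`. This block is central, the remaining word still contains `h` and so still
generates `G`, and by `single_pow_mul_conj` the block may be replaced by `g^(ord h)`. Hence `g`
splits off on the left. Left multiplications are therefore surjections of finite sets. Beyond a type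
where the cardinality is minimal they are bijections (`exists_stableFrom`), and there generating
classes are the same as fractions of the given type (`genClassesEquiv`).

Fractions: words in `Γ` become units, because every letter divides the central `u_Γ`. Sending `b̂`
to a `Γ`-word of evaluation `b` defines a homomorphism from `G_Γ` to these units
(`exists_tautGroup_hom`). It identifies `[G_Γ, G_Γ]` with the kernel of `ν` on fractions
(`exists_commutator_equiv`).

Count: `G_Γ → G` is a central extension. It maps `[G_Γ, G_Γ]` onto `[G, G]`, with the cosets of
`H_{2,Γ}` as fibres (`card_fiber_boundary`). Finiteness follows because commutators in `G_Γ` depend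
only on their images in `G`. -/

namespace HurwitzMonoid

variable {G : Type*}

/-! ### Words with entries in a set, and basic invariants of braid classes -/

/-- All entries of the Hurwitz vector `v` lie in `Γ`. -/
def EntriesIn (Γ : Set G) (v : HurwitzVector G) : Prop := ∀ g ∈ v.toList, g ∈ Γ

theorem entriesIn_one (Γ : Set G) : EntriesIn Γ 1 := by
  intro g hg
  simp at hg

theorem entriesIn_of {Γ : Set G} {g : G} : EntriesIn Γ (FreeMonoid.of g) ↔ g ∈ Γ := by
  simp [EntriesIn]

theorem entriesIn_mul {Γ : Set G} {v w : HurwitzVector G} :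
    EntriesIn Γ (v * w) ↔ EntriesIn Γ v ∧ EntriesIn Γ w := by
  simp [EntriesIn, or_imp, forall_and]

theorem entriesIn_pow {Γ : Set G} {v : HurwitzVector G} (hv : EntriesIn Γ v) (n : ℕ) :
    EntriesIn Γ (v ^ n) := by
  induction n with
  | zero => simpa using entriesIn_one Γ
  | succ n ih => rw [pow_succ]; exact entriesIn_mul.2 ⟨ih, hv⟩

variable [Group G]

/-- The braid class of a Hurwitz vector of length one. -/
def single (g : G) : HClass G := cls (FreeMonoid.of g)

theorem cls_surjective : Function.Surjective (cls : HurwitzVector G → HClass G) :=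
  (braidCon G).mk'_surjective

theorem nielsen_mul (x y : HClass G) : nielsen (x * y) = nielsen x + nielsen y := by
  simp [nielsen]

theorem nielsen_pow (x : HClass G) (n : ℕ) : nielsen (x ^ n) = n • nielsen x := by
  simp [nielsen]

theorem nielsen_single (g : G) : nielsen (single g) = Finsupp.single (ConjClasses.mk g) 1 := by
  simp [single, nielsen_cls, nielsenVec, nielsenHomVec]

theorem nielsenVec_one : nielsenVec (1 : HurwitzVector G) = 0 := by
  simp [nielsenVec]

theorem nielsenVec_of (g : G) :
    nielsenVec (FreeMonoid.of g) = Finsupp.single (ConjClasses.mk g) 1 := by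
  simp [nielsenVec, nielsenHomVec]

theorem nielsenVec_mul (v w : HurwitzVector G) :
    nielsenVec (v * w) = nielsenVec v + nielsenVec w := by
  simp [nielsenVec]

theorem nielsenVec_pow (v : HurwitzVector G) (n : ℕ) :
    nielsenVec (v ^ n) = n • nielsenVec v := by
  simp [nielsenVec]

theorem nielsenVec_nonneg (v : HurwitzVector G) : 0 ≤ nielsenVec v := by
  classical
  intro C
  rw [nielsenVec_apply]
  simp

theorem gen_mul (x y : HClass G) : gen (x * y) = gen x ⊔ gen y := by
  obtain ⟨v, rfl⟩ := cls_surjective x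
  obtain ⟨w, rfl⟩ := cls_surjective y
  rw [← map_mul, gen_cls, gen_cls, gen_cls, genVec, genVec, genVec, ← Subgroup.closure_union]
  congr 1
  ext g
  simp

theorem gen_single (g : G) : gen (single g) = Subgroup.closure {g} := by
  rw [single, gen_cls, genVec]
  congr 1
  ext
  simp

theorem gen_pow_le (x : HClass G) (n : ℕ) : gen (x ^ n) ≤ gen x := by
  induction n with
  | zero =>
    rw [pow_zero, ← map_one cls, gen_cls, genVec]
    simp
  | succ n ih => rw [pow_succ, gen_mul]; exact sup_le ih le_rfl

theorem evalVec_of (g : G) : evalVec G (FreeMonoid.of g) = g := by simp [evalVec]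

theorem ev_single (g : G) : ev G (single g) = g := by rw [single, ev_cls, evalVec_of]

theorem central_of_ev_eq_one {x : HClass G} (hx : ev G x = 1) (y : HClass G) : Commute y x := by
  obtain ⟨v, rfl⟩ := cls_surjective x
  exact cls_central v hx y

theorem single_mul (a : G) (x : HClass G) :
    single a * x = x * single ((ev G x)⁻¹ * a * ev G x) := by
  obtain ⟨v, rfl⟩ := cls_surjective x
  exact cls_of_mul a v

theorem cls_mul_single (v : HurwitzVector G) (h : G) :
    cls v * single h = single h * cls (FreeMonoid.map (fun a => h⁻¹ * a * h) v) := by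
  induction v using FreeMonoid.inductionOn' with
  | one => simp
  | of_mul a v ih =>
    rw [map_mul, mul_assoc, ih, map_mul, map_mul, FreeMonoid.map_of, ← mul_assoc, ← mul_assoc]
    congr 1
    have := single_mul a (single h)
    rwa [ev_single] at this

/-! ### Moving entries to the front -/

open Classical in
-- Pulling `h` to the front conjugates the letters it passes by `h`. This fixes `h` itself, so
-- exactly one occurrence of `h` is used up.
theorem exists_eq_single_mul {v : HurwitzVector G} {h : G} (hv : h ∈ v.toList) :
    ∃ w : HurwitzVector G, cls v = single h * cls w ∧
      v.toList.count h = w.toList.count h + 1 ∧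
      ∀ Γ : Set G, (∀ a ∈ Γ, ∀ g : G, g⁻¹ * a * g ∈ Γ) → EntriesIn Γ v → EntriesIn Γ w := by
  obtain ⟨a, b, hab⟩ := List.append_of_mem hv
  have hv' : v = FreeMonoid.ofList a * (FreeMonoid.of h * FreeMonoid.ofList b) := hab
  subst hv'
  refine ⟨FreeMonoid.map (fun x => h⁻¹ * x * h) (FreeMonoid.ofList a) * FreeMonoid.ofList b,
    ?_, ?_, ?_⟩
  · rw [map_mul, map_mul, map_mul, ← mul_assoc, ← mul_assoc]
    congr 1
    exact cls_mul_single _ _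
  · have key : (a.map fun x => h⁻¹ * x * h).count h = a.count h := by
      have hinj : Function.Injective fun x : G => h⁻¹ * x * h := fun x y hxy => by
        simpa using hxy
      have := List.count_map_of_injective a _ hinj h
      simpa using this
    simp only [FreeMonoid.toList_mul, FreeMonoid.toList_map, FreeMonoid.toList_ofList,
      FreeMonoid.toList_of, List.count_append, key, List.count_cons_self, List.count_nil]
    omega
  · intro Γ hΓ hE
    rw [entriesIn_mul, entriesIn_mul] at hE
    refine entriesIn_mul.2 ⟨?_, hE.2.2⟩
    intro g hg
    rw [FreeMonoid.toList_map] at hg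
    obtain ⟨x, hx, rfl⟩ := List.mem_map.1 hg
    exact hΓ _ (hE.1 x hx) _

open Classical in
theorem exists_eq_single_pow_mul (h : G) (k : ℕ) (v : HurwitzVector G)
    (hk : k ≤ v.toList.count h) :
    ∃ w : HurwitzVector G, cls v = single h ^ k * cls w ∧
      v.toList.count h = w.toList.count h + k := by
  induction k generalizing v with
  | zero => exact ⟨v, by simp, by simp⟩
  | succ k ih =>
    obtain ⟨w, h₁, h₂, -⟩ := exists_eq_single_mul (v := v) (h := h) (List.count_pos_iff.1 (by omega))
    obtain ⟨w', h₃, h₄⟩ := ih w (by omega)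
    exact ⟨w', by rw [h₁, h₃, pow_succ', mul_assoc], by omega⟩

/-! ### Central powers -/

theorem central_single_pow {h : G} {n : ℕ} (hn : h ^ n = 1) (y : HClass G) :
    Commute y (single h ^ n) :=
  central_of_ev_eq_one (by rw [map_pow, ev_single, hn]) y

theorem single_pow_mul_single (h s : G) (n : ℕ) :
    single h ^ n * single s = single s * single (s⁻¹ * h * s) ^ n := by
  have : SemiconjBy (single s) (single (s⁻¹ * h * s)) (single h) := by
    have := single_mul h (single s)
    rw [ev_single] at this
    exact this.symm
  exact (this.pow_right n).eq.symm

/-- The block `h^n` is central, so it can be slid next to an entry `s` of `w`. Crossing `s`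
conjugates it, and the new block is again central and slides back. Conjugations compose, which
passes from entries to the subgroup they generate; `h` is quantified last because the induction
changes it. -/
theorem single_pow_mul_conj {w : HurwitzVector G} {n : ℕ} {s : G} (hs : s ∈ genVec w) :
    ∀ {h : G}, h ^ n = 1 → single h ^ n * cls w = single (s⁻¹ * h * s) ^ n * cls w := by
  have hpow : ∀ {h : G} (s : G), h ^ n = 1 → (s⁻¹ * h * s) ^ n = 1 := by
    intro h s hh
    have := conj_pow (i := n) (a := s⁻¹) (b := h)
    rw [inv_inv] at this
    rw [this, hh]
    simp
  induction hs using Subgroup.closure_induction with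
  | mem s hs =>
    intro h hh
    obtain ⟨a, b, hab⟩ := List.append_of_mem hs
    have hw : w = FreeMonoid.ofList a * (FreeMonoid.of s * FreeMonoid.ofList b) := hab
    have hw' : cls w = cls (FreeMonoid.ofList a) * (single s * cls (FreeMonoid.ofList b)) := by
      rw [hw, map_mul, map_mul]; rfl
    rw [hw', ← mul_assoc, ← (central_single_pow hh (cls (FreeMonoid.ofList a))).eq, mul_assoc,
      ← mul_assoc (single h ^ n), single_pow_mul_single,
      ← (central_single_pow (hpow s hh) (single s)).symm.eq, mul_assoc, ← mul_assoc,
      (central_single_pow (hpow s hh) (cls (FreeMonoid.ofList a))).eq, mul_assoc]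
  | one => intro h _; simp
  | mul s t _ _ ihs iht =>
    intro h hh
    rw [ihs hh, iht (hpow s hh)]
    congr 3
    group
  | inv s _ ih =>
    intro h hh
    -- The induction hypothesis for `s h s⁻¹`, used from right to left.
    have := ih (hpow s⁻¹ hh)
    rw [this]
    congr 3
    group

/-! ### The entries of `u_Γ` -/

open Classical in
theorem countP_eq_sum_count [Fintype G] (l : List G) (C : ConjClasses G) :
    (l.countP fun g => ConjClasses.mk g = C) =
      ∑ h ∈ Finset.univ.filter (fun h : G => ConjClasses.mk h = C), l.count h := by
  induction l with
  | nil => simp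
  | cons a l ih =>
    simp only [List.countP_cons, ih, List.count_cons, Finset.sum_add_distrib]
    congr 1
    simp [Finset.sum_ite_eq]

section Finite

variable [Finite G]

theorem mem_uVec {Γ : Set G} {g : G} : g ∈ (uVec Γ).toList ↔ g ∈ Γ := by
  simp only [uVec, FreeMonoid.toList_ofList, List.mem_flatMap, Finset.mem_toList,
    Set.Finite.mem_toFinset, List.mem_replicate]
  constructor
  · rintro ⟨a, ha, -, rfl⟩
    exact ha
  · exact fun hg => ⟨g, hg, (orderOf_pos g).ne', rfl⟩

theorem entriesIn_uVec (Γ : Set G) : EntriesIn Γ (uVec Γ) := fun _ => mem_uVec.1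

open Classical in
-- Only this bound is needed: an element of `Γ` more frequent in `v` than in `u_Γ` occurs more than
-- its order many times in `v`.
theorem orderOf_le_count_uVec {Γ : Set G} {g : G} (hg : g ∈ Γ) :
    orderOf g ≤ (uVec Γ).toList.count g := by
  have hg' : g ∈ (Set.toFinite Γ).toFinset.toList := by simpa using hg
  rw [uVec, FreeMonoid.toList_ofList]
  obtain ⟨a, b, hab⟩ := List.append_of_mem hg'
  rw [hab]
  simp only [List.flatMap_append, List.flatMap_cons, List.count_append, List.count_replicate_self]
  omega

theorem ev_uCls (Γ : Set G) : ev G (uCls Γ) = 1 := evalVec_uVec Γ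

theorem uCls_central (Γ : Set G) (x : HClass G) : Commute x (uCls Γ) :=
  central_of_ev_eq_one (ev_uCls Γ) x

theorem uCls_pow_central (Γ : Set G) (n : ℕ) (x : HClass G) : Commute x (uCls Γ ^ n) :=
  (uCls_central Γ x).pow_right n

theorem exists_single_mul_eq_uCls {Γ : Set G} (hΓ : ∀ a ∈ Γ, ∀ g : G, g⁻¹ * a * g ∈ Γ) {g : G}
    (hg : g ∈ Γ) : ∃ c : HurwitzVector G, EntriesIn Γ c ∧ uCls Γ = single g * cls c := by
  obtain ⟨c, h₁, -, h₂⟩ := exists_eq_single_mul (mem_uVec.2 hg)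
  exact ⟨c, h₂ Γ hΓ (entriesIn_uVec Γ), h₁⟩

/-- Each letter of `Γ` divides the central class `u_Γ`. The complements of the letters, in reverse
order, give `w`. -/
theorem exists_mul_eq_uCls_pow {Γ : Set G} (hΓ : ∀ a ∈ Γ, ∀ g : G, g⁻¹ * a * g ∈ Γ)
    {v : HurwitzVector G} (hv : EntriesIn Γ v) :
    ∃ (w : HurwitzVector G) (N : ℕ), EntriesIn Γ w ∧ cls v * cls w = uCls Γ ^ N := by
  induction v using FreeMonoid.inductionOn' with
  | one => exact ⟨1, 0, entriesIn_one Γ, by simp⟩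
  | of_mul g v ih =>
    rw [entriesIn_mul, entriesIn_of] at hv
    obtain ⟨w, N, hw, h⟩ := ih hv.2
    obtain ⟨c, hc, hu⟩ := exists_single_mul_eq_uCls hΓ hv.1
    refine ⟨w * c, N + 1, entriesIn_mul.2 ⟨hw, hc⟩, ?_⟩
    rw [map_mul, map_mul, mul_assoc, ← mul_assoc (cls v), h, ← mul_assoc,
      (uCls_pow_central Γ N _).eq, mul_assoc, pow_succ, hu]
    rfl

end Finite

end HurwitzMonoid

namespace HurwitzMonoid

variable {G : Type*} [Group G]

/-! ### Nielsen types of words with entries in `Γ` -/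

theorem exists_mem_of_single_le {g : G} {v : HurwitzVector G}
    (h : Finsupp.single (ConjClasses.mk g) 1 ≤ nielsenVec v) :
    ∃ a ∈ v.toList, IsConj a g := by
  classical
  have h1 := h (ConjClasses.mk g)
  rw [Finsupp.single_eq_same, nielsenVec_apply] at h1
  obtain ⟨a, ha, hag⟩ := List.countP_pos_iff.1 (by exact_mod_cast h1 :
    0 < v.toList.countP fun a => ConjClasses.mk a = ConjClasses.mk g)
  exact ⟨a, ha, ConjClasses.mk_eq_mk_iff_isConj.1 (by simpa using hag)⟩

theorem single_le_of_mem {g : G} {v : HurwitzVector G} (h : g ∈ v.toList) :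
    Finsupp.single (ConjClasses.mk g) 1 ≤ nielsenVec v := by
  obtain ⟨a, b, hab⟩ := List.append_of_mem h
  have hv : v = FreeMonoid.ofList a * (FreeMonoid.of g * FreeMonoid.ofList b) := hab
  rw [hv, nielsenVec_mul, nielsenVec_mul, nielsenVec_of]
  have h₁ := nielsenVec_nonneg (FreeMonoid.ofList a)
  have h₂ := nielsenVec_nonneg (FreeMonoid.ofList b)
  rw [← add_assoc, add_right_comm]
  exact le_add_of_nonneg_left (add_nonneg h₁ h₂)

theorem mem_of_isConj {Γ : Set G} (hΓ : ∀ a ∈ Γ, ∀ g : G, g⁻¹ * a * g ∈ Γ) {a b : G}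
    (ha : a ∈ Γ) (h : IsConj a b) : b ∈ Γ := by
  obtain ⟨c, rfl⟩ := isConj_iff.1 h
  simpa using hΓ a ha c⁻¹

theorem EntriesIn.of_nielsenVec_le {Γ : Set G} (hΓ : ∀ a ∈ Γ, ∀ g : G, g⁻¹ * a * g ∈ Γ)
    {v w : HurwitzVector G} (hv : EntriesIn Γ v) (h : nielsenVec w ≤ nielsenVec v) :
    EntriesIn Γ w := by
  intro g hg
  obtain ⟨a, ha, hag⟩ := exists_mem_of_single_le ((single_le_of_mem hg).trans h)
  exact mem_of_isConj hΓ (hv a ha) hag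

/-- For each letter of `w`, delete a conjugate letter from `v`. -/
theorem exists_nielsenVec_eq_add {Γ : Set G} {w v : HurwitzVector G} (hv : EntriesIn Γ v)
    (h : nielsenVec w ≤ nielsenVec v) :
    ∃ v' : HurwitzVector G, EntriesIn Γ v' ∧ nielsenVec v = nielsenVec w + nielsenVec v' := by
  induction w using FreeMonoid.inductionOn' generalizing v with
  | one => exact ⟨v, hv, by simp [nielsenVec_one]⟩
  | of_mul g w ih =>
    rw [nielsenVec_mul, nielsenVec_of] at h
    obtain ⟨a, ha, hag⟩ := exists_mem_of_single_le
      ((le_add_of_nonneg_right (nielsenVec_nonneg w)).trans h)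
    obtain ⟨p, q, hpq⟩ := List.append_of_mem ha
    have hv' : v = FreeMonoid.ofList p * (FreeMonoid.of a * FreeMonoid.ofList q) := hpq
    have hν : nielsenVec v = Finsupp.single (ConjClasses.mk g) 1 +
        nielsenVec (FreeMonoid.ofList p * FreeMonoid.ofList q) := by
      rw [hv', nielsenVec_mul, nielsenVec_mul, nielsenVec_of, nielsenVec_mul,
        ConjClasses.mk_eq_mk_iff_isConj.2 hag]
      exact add_left_comm _ _ _
    rw [hv', entriesIn_mul, entriesIn_mul] at hv
    rw [hν] at h
    obtain ⟨v', h₁, h₂⟩ := ih (entriesIn_mul.2 ⟨hv.1, hv.2.2⟩) (le_of_add_le_add_left h)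
    exact ⟨v', h₁, by rw [hν, h₂, nielsenVec_mul, nielsenVec_of, add_assoc]⟩

theorem length_eq_sum_nielsenVec (v : HurwitzVector G) :
    (v.toList.length : ℤ) = (nielsenVec v).sum fun _ n => n := by
  induction v using FreeMonoid.inductionOn' with
  | one => simp [nielsenVec_one]
  | of_mul g v ih =>
    rw [nielsenVec_mul, nielsenVec_of, Finsupp.sum_add_index' (by simp) (by simp), ← ih]
    simp [add_comm]

variable [Finite G]

theorem nielsenVec_le_smul_uVec {Γ : Set G} {v : HurwitzVector G} (hv : EntriesIn Γ v) :
    ∃ m : ℕ, nielsenVec v ≤ m • nielsenVec (uVec Γ) := by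
  induction v using FreeMonoid.inductionOn' with
  | one => exact ⟨0, by simp [nielsenVec_one]⟩
  | of_mul g v ih =>
    rw [entriesIn_mul, entriesIn_of] at hv
    obtain ⟨m, hm⟩ := ih hv.2
    refine ⟨m + 1, ?_⟩
    rw [nielsenVec_mul, nielsenVec_of, succ_nsmul']
    exact add_le_add (single_le_of_mem (mem_uVec.2 hv.1)) hm

/-- The type determines the length, and there are finitely many words of each length. -/
theorem finite_genClasses (ν : NielsenGroup G) : (genClasses ν).Finite := by
  refine Set.Finite.subset ((List.finite_length_eq G (ν.sum fun _ n => n).toNat).image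
    fun l => cls (FreeMonoid.ofList l)) ?_
  rintro x ⟨hx, -⟩
  obtain ⟨v, rfl⟩ := cls_surjective x
  refine ⟨v.toList, ?_, rfl⟩
  rw [nielsen_cls] at hx
  have := length_eq_sum_nielsenVec v
  rw [hx] at this
  simp only [Set.mem_ofPred_eq]
  omega

/-! ### Stabilisation -/

theorem exists_single_mul_of_mem_genClasses {Γ : Set G}
    (hΓ : ∀ a ∈ Γ, ∀ g : G, g⁻¹ * a * g ∈ Γ) {g : G} (hg : g ∈ Γ) {ν : NielsenGroup G}
    (hν : nielsenVec (uVec Γ) ≤ ν) {x : HClass G}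
    (hx : x ∈ genClasses (Finsupp.single (ConjClasses.mk g) 1 + ν)) :
    ∃ y ∈ genClasses ν, x = single g * y := by
  classical
  have := Fintype.ofFinite G
  obtain ⟨v, rfl⟩ := cls_surjective x
  obtain ⟨hx, hgen⟩ := hx
  -- Pigeonhole: `v` has more entries in the class of `g` than `u_Γ` has.
  obtain ⟨h, hhC, hh⟩ : ∃ h ∈ Finset.univ.filter
      (fun h : G => ConjClasses.mk h = ConjClasses.mk g),
      (uVec Γ).toList.count h < v.toList.count h := by
    apply Finset.exists_lt_of_sum_lt
    rw [← countP_eq_sum_count, ← countP_eq_sum_count]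
    have h₁ := hν (ConjClasses.mk g)
    have h₂ := DFunLike.congr_fun hx (ConjClasses.mk g)
    rw [nielsen_cls, Finsupp.add_apply, Finsupp.single_eq_same] at h₂
    have h₃ : nielsenVec (uVec Γ) (ConjClasses.mk g) < nielsenVec v (ConjClasses.mk g) := by omega
    rw [nielsenVec_apply, nielsenVec_apply, Nat.cast_lt] at h₃
    refine (lt_of_eq_of_lt ?_ h₃).trans_eq ?_ <;> congr!
  have hconj : IsConj h g := ConjClasses.mk_eq_mk_iff_isConj.1 (by simpa using hhC)
  have hhΓ : h ∈ Γ := mem_of_isConj hΓ hg hconj.symm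
  have hle := orderOf_le_count_uVec hhΓ
  -- At least `ord h + 1` copies of `h` are present and only `ord h` are extracted, so `w` still
  -- contains `h` and generates `G`.
  obtain ⟨w, h₁, h₂⟩ := exists_eq_single_pow_mul h (orderOf h) v (by omega)
  have hw : genVec w = ⊤ := by
    rw [h₁, gen_mul, gen_cls] at hgen
    rw [eq_top_iff, ← hgen]
    refine sup_le ((gen_pow_le _ _).trans ?_) le_rfl
    rw [gen_single, Subgroup.closure_le, Set.singleton_subset_iff]
    exact Subgroup.subset_closure (List.count_pos_iff.1 (by omega))
  obtain ⟨c, hc⟩ := isConj_iff.1 hconj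
  have key := single_pow_mul_conj (w := w) (s := c⁻¹) (by rw [hw]; trivial)
    (pow_orderOf_eq_one h)
  rw [inv_inv, hc] at key
  obtain ⟨n, hn⟩ := Nat.exists_eq_succ_of_ne_zero (orderOf_pos h).ne'
  have hxy : cls v = single g * (single g ^ n * cls w) := by
    rw [h₁, key, hn, pow_succ', mul_assoc]
  refine ⟨single g ^ n * cls w, ⟨?_, ?_⟩, hxy⟩
  · rw [hxy, nielsen_mul, nielsen_single] at hx
    exact add_left_cancel hx
  · rw [gen_mul, gen_cls, hw, sup_top_eq]

theorem exists_cls_mul_of_mem_genClasses {Γ : Set G}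
    (hΓ : ∀ a ∈ Γ, ∀ g : G, g⁻¹ * a * g ∈ Γ) {v : HurwitzVector G} (hv : EntriesIn Γ v)
    {ν : NielsenGroup G} (hν : nielsenVec (uVec Γ) ≤ ν) {x : HClass G}
    (hx : x ∈ genClasses (nielsenVec v + ν)) :
    ∃ y ∈ genClasses ν, x = cls v * y := by
  induction v using FreeMonoid.inductionOn' generalizing x with
  | one => exact ⟨x, by simpa [nielsenVec_one] using hx, by simp⟩
  | of_mul g v ih =>
    rw [entriesIn_mul, entriesIn_of] at hv
    rw [nielsenVec_mul, nielsenVec_of, add_assoc] at hx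
    obtain ⟨y, hy, rfl⟩ := exists_single_mul_of_mem_genClasses hΓ hv.1
      (hν.trans (le_add_of_nonneg_left (nielsenVec_nonneg v))) hx
    obtain ⟨z, hz, rfl⟩ := ih hv.2 hy
    exact ⟨z, hz, by rw [map_mul, mul_assoc]; rfl⟩

theorem genClasses_subset_image {Γ : Set G}
    (hΓ : ∀ a ∈ Γ, ∀ g : G, g⁻¹ * a * g ∈ Γ) {v : HurwitzVector G} (hv : EntriesIn Γ v)
    {ν : NielsenGroup G} (hν : nielsenVec (uVec Γ) ≤ ν) :
    genClasses (nielsenVec v + ν) ⊆ (fun y => cls v * y) '' genClasses ν := by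
  intro x hx
  obtain ⟨y, hy, rfl⟩ := exists_cls_mul_of_mem_genClasses hΓ hv hν hx
  exact ⟨y, hy, rfl⟩

/-- The number `m` bounds the stable range for `Γ`: the Nielsen types `ν ≥ m ν(u_Γ)` are those
from which on left multiplication by elements of `Γ` is injective on generating classes. -/
def StableFrom (Γ : Set G) (m : ℕ) : Prop :=
  ∀ v₀ : HurwitzVector G, EntriesIn Γ v₀ → m • nielsenVec (uVec Γ) ≤ nielsenVec v₀ →
    nielsenVec (uVec Γ) ≤ nielsenVec v₀ ∧
    ∀ v : HurwitzVector G, EntriesIn Γ v →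
      Set.InjOn (fun y => cls v * y) (genClasses (nielsenVec v₀))

theorem StableFrom.mono {Γ : Set G} {m n : ℕ} (h : StableFrom Γ m) (hmn : m ≤ n) :
    StableFrom Γ n := fun v₀ hv₀ hle =>
  h v₀ hv₀ ((nsmul_le_nsmul_left (nielsenVec_nonneg _) hmn).trans hle)

/-- By stabilisation the cardinalities do not increase. Beyond a word `w` that minimises them they
are constant, and a surjection between finite sets of equal size is injective. -/
theorem exists_stableFrom {Γ : Set G} (hΓ : ∀ a ∈ Γ, ∀ g : G, g⁻¹ * a * g ∈ Γ) :
    ∃ m, StableFrom Γ m := by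
  have hmono : ∀ {v : HurwitzVector G}, EntriesIn Γ v → ∀ {ν : NielsenGroup G},
      nielsenVec (uVec Γ) ≤ ν →
      (genClasses (nielsenVec v + ν)).ncard ≤ (genClasses ν).ncard := fun hv ν hν =>
    (Set.ncard_le_ncard (genClasses_subset_image hΓ hv hν)
      ((finite_genClasses ν).image _)).trans (Set.ncard_image_le (finite_genClasses ν))
  let f : {v : HurwitzVector G // EntriesIn Γ v} → ℕ := fun v =>
    (genClasses (nielsenVec v.1 + nielsenVec (uVec Γ))).ncard
  have hne : Nonempty {v : HurwitzVector G // EntriesIn Γ v} := ⟨1, entriesIn_one Γ⟩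
  let w := Function.argmin f
  have hw : ∀ v, f w ≤ f v := fun v => Function.argmin_le f v
  obtain ⟨m, hm⟩ := nielsenVec_le_smul_uVec (entriesIn_mul.2 ⟨w.2, entriesIn_uVec Γ⟩)
  refine ⟨m, fun v₀ hv₀ hle => ?_⟩
  have hle' := hm.trans hle
  obtain ⟨v', hv', hν⟩ := exists_nielsenVec_eq_add hv₀ hle'
  have hu : nielsenVec (uVec Γ) ≤ nielsenVec v₀ := by
    refine le_trans ?_ hle'
    rw [nielsenVec_mul]
    exact le_add_of_nonneg_left (nielsenVec_nonneg _)
  refine ⟨hu, fun v hv => ?_⟩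
  refine Set.injOn_of_ncard_image_eq (le_antisymm (Set.ncard_image_le (finite_genClasses _)) ?_)
    (finite_genClasses _)
  have h₁ : (genClasses (nielsenVec v₀)).ncard ≤ f w := by
    rw [hν, add_comm, nielsenVec_mul]
    exact hmono hv' (le_add_of_nonneg_left (nielsenVec_nonneg _))
  -- With the complement `v'` included, minimality of `w` is tested exactly at the type `ν(v) +
  -- ν(v₀)`.
  have h₂ := hw ⟨v * w.1 * v', entriesIn_mul.2 ⟨entriesIn_mul.2 ⟨hv, w.2⟩, hv'⟩⟩
  refine (h₁.trans h₂).trans (Set.ncard_le_ncard ?_ ((finite_genClasses _).image _))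
  have h₃ : nielsenVec (v * w.1 * v') + nielsenVec (uVec Γ) =
      nielsenVec v + nielsenVec v₀ := by
    rw [hν]
    simp only [nielsenVec_mul]
    abel
  change genClasses (nielsenVec (v * w.1 * v') + nielsenVec (uVec Γ)) ⊆ _
  rw [h₃]
  exact genClasses_subset_image hΓ hv hu

variable (G) in
-- `G` has only finitely many subsets `Γ`, so the individual bounds have a common upper bound
-- depending on `G` alone.
theorem exists_forall_stableFrom :
    ∃ m, ∀ Γ : Set G, (∀ a ∈ Γ, ∀ g : G, g⁻¹ * a * g ∈ Γ) → StableFrom Γ m := by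
  have h : ∀ Γ : Set G, ∃ m, (∀ a ∈ Γ, ∀ g : G, g⁻¹ * a * g ∈ Γ) → StableFrom Γ m := by
    intro Γ
    by_cases hΓ : ∀ a ∈ Γ, ∀ g : G, g⁻¹ * a * g ∈ Γ
    · obtain ⟨m, hm⟩ := exists_stableFrom hΓ
      exact ⟨m, fun _ => hm⟩
    · exact ⟨0, fun h => absurd h hΓ⟩
  choose m hm using h
  obtain ⟨M, hM⟩ := (Set.finite_range m).bddAbove
  exact ⟨M, fun Γ hΓ => (hm Γ hΓ).mono (hM ⟨Γ, rfl⟩)⟩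

end HurwitzMonoid

namespace HurwitzMonoid

variable {G : Type*} [Group G] [Finite G]

/-! ### The monoid of fractions -/

/-- The canonical homomorphism from the Hurwitz class monoid to its monoid of fractions. -/
noncomputable def toLoc (Γ : Set G) : HClass G →* Loc Γ := OreLocalization.numeratorHom

/-- Both denominators are `1`, so the two multipliers in the Ore criterion coincide and are a power
of `u_Γ`. -/
theorem toLoc_eq_iff {Γ : Set G} {x y : HClass G} :
    toLoc Γ x = toLoc Γ y ↔ ∃ k : ℕ, uCls Γ ^ k * x = uCls Γ ^ k * y := by
  constructor
  · intro h
    obtain ⟨⟨_, k, rfl⟩, v, h₁, h₂⟩ := OreLocalization.oreDiv_eq_iff.1 h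
    rw [Submonoid.coe_one, mul_one, mul_one] at h₂
    subst h₂
    exact ⟨k, h₁.symm⟩
  · rintro ⟨k, h⟩
    exact OreLocalization.oreDiv_eq_iff.2 ⟨⟨uCls Γ ^ k, k, rfl⟩, uCls Γ ^ k, h.symm, rfl⟩

theorem isUnit_toLoc_uCls_pow (Γ : Set G) (k : ℕ) : IsUnit (toLoc Γ (uCls Γ ^ k)) :=
  OreLocalization.numerator_isUnit (⟨uCls Γ ^ k, k, rfl⟩ : denom Γ)

theorem toLoc_mul_frac (Γ : Set G) (x : HClass G) (l : ℕ) :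
    toLoc Γ (uCls Γ ^ l) * frac Γ x l = toLoc Γ x :=
  OreLocalization.mul_cancel (s := (⟨uCls Γ ^ l, l, rfl⟩ : denom Γ)) (t := 1)

theorem exists_eq_frac {Γ : Set G} (p : Loc Γ) : ∃ x l, p = frac Γ x l := by
  induction p using OreLocalization.ind with
  | _ r s =>
    obtain ⟨_, l, rfl⟩ := s
    exact ⟨r, l, rfl⟩

theorem commute_toLoc {Γ : Set G} {x : HClass G} (hx : ∀ y, Commute y x) (p : Loc Γ) :
    Commute p (toLoc Γ x) := by
  obtain ⟨y, l, rfl⟩ := exists_eq_frac p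
  apply (isUnit_toLoc_uCls_pow Γ l).mul_left_cancel
  rw [← mul_assoc, toLoc_mul_frac, ← mul_assoc, ← map_mul, ← map_mul, (hx (uCls Γ ^ l)).eq,
    (hx y).eq, map_mul, map_mul, mul_assoc, toLoc_mul_frac]

theorem commute_toLoc_uCls_pow {Γ : Set G} (p : Loc Γ) (l : ℕ) :
    Commute p (toLoc Γ (uCls Γ ^ l)) :=
  commute_toLoc (uCls_pow_central Γ l) p

theorem frac_mul_toLoc (Γ : Set G) (x : HClass G) (l : ℕ) :
    frac Γ x l * toLoc Γ (uCls Γ ^ l) = toLoc Γ x := by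
  rw [(commute_toLoc_uCls_pow _ l).eq, toLoc_mul_frac]

theorem eq_frac_iff {Γ : Set G} {p : Loc Γ} {x : HClass G} {l : ℕ} :
    p = frac Γ x l ↔ p * toLoc Γ (uCls Γ ^ l) = toLoc Γ x := by
  rw [← frac_mul_toLoc Γ x l]
  exact (isUnit_toLoc_uCls_pow Γ l).mul_left_inj.symm

/-- The extension of the evaluation to the monoid of fractions. -/
noncomputable def evLoc (Γ : Set G) : Loc Γ →* G :=
  OreLocalization.universalMulHom (ev G)
    (toUnits.toMonoidHom.comp ((ev G).comp (denom Γ).subtype)) fun _ => rfl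

theorem evLoc_toLoc {Γ : Set G} (x : HClass G) : evLoc Γ (toLoc Γ x) = ev G x :=
  OreLocalization.universalMulHom_commutes _ _ _

theorem nielsenLoc_toLoc {Γ : Set G} (x : HClass G) :
    nielsenLoc Γ (toLoc Γ x) = Multiplicative.ofAdd (nielsen x) :=
  OreLocalization.universalMulHom_commutes _ _ _

theorem evLoc_frac {Γ : Set G} (x : HClass G) (l : ℕ) : evLoc Γ (frac Γ x l) = ev G x := by
  have := congrArg (evLoc Γ) (frac_mul_toLoc Γ x l)
  rwa [map_mul, evLoc_toLoc, evLoc_toLoc, map_pow, ev_uCls, one_pow, mul_one] at this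

/-- The class `u_Γ` evaluates to `1`, so the numerator does too and is central. This is what kills
`[F, R]` when `G_Γ` is mapped to fractions. -/
theorem commute_of_evLoc_eq_one {Γ : Set G} {p : Loc Γ} (hp : evLoc Γ p = 1) (q : Loc Γ) :
    Commute q p := by
  obtain ⟨x, l, rfl⟩ := exists_eq_frac p
  rw [evLoc_frac] at hp
  apply (isUnit_toLoc_uCls_pow Γ l).mul_right_cancel
  rw [mul_assoc, frac_mul_toLoc, mul_assoc, (commute_toLoc_uCls_pow q l).eq, ← mul_assoc,
    frac_mul_toLoc, (commute_toLoc (central_of_ev_eq_one hp) q).eq]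

/-- A complement `w` of `v` has a left inverse coming from `v` and a right inverse coming from its
own complement. So `w` is a unit, and then so is `v`. -/
theorem isUnit_toLoc_cls {Γ : Set G} (hΓ : ∀ a ∈ Γ, ∀ g : G, g⁻¹ * a * g ∈ Γ)
    {v : HurwitzVector G} (hv : EntriesIn Γ v) : IsUnit (toLoc Γ (cls v)) := by
  obtain ⟨w, N, hw, h₁⟩ := exists_mul_eq_uCls_pow hΓ hv
  obtain ⟨v', M, -, h₂⟩ := exists_mul_eq_uCls_pow hΓ hw
  have h₁' := congrArg (toLoc Γ) h₁
  have h₂' := congrArg (toLoc Γ) h₂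
  rw [map_mul] at h₁' h₂'
  obtain ⟨a, ha⟩ := isUnit_toLoc_uCls_pow Γ N
  obtain ⟨b, hb⟩ := isUnit_toLoc_uCls_pow Γ M
  rw [← ha] at h₁'
  rw [← hb] at h₂'
  have hwu : IsUnit (toLoc Γ (cls w)) := by
    rw [isUnit_iff_exists_and_exists]
    refine ⟨⟨toLoc Γ (cls v') * ↑b⁻¹, by rw [← mul_assoc, h₂', Units.mul_inv]⟩,
      ⟨↑a⁻¹ * toLoc Γ (cls v), by rw [mul_assoc, h₁', Units.inv_mul]⟩⟩
  obtain ⟨c, hc⟩ := hwu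
  rw [← hc] at h₁'
  rw [(Units.eq_mul_inv_iff_mul_eq c).2 h₁', ← Units.val_mul]
  exact Units.isUnit _

/-- Every fraction whose Nielsen type is that of a word in `Γ` is represented by words in `Γ`. -/
theorem exists_eq_frac_cls {Γ : Set G} (hΓ : ∀ a ∈ Γ, ∀ g : G, g⁻¹ * a * g ∈ Γ)
    {v₀ : HurwitzVector G} (hv₀ : EntriesIn Γ v₀) {p : Loc Γ}
    (hp : nielsenLoc Γ p = Multiplicative.ofAdd (nielsenVec v₀)) :
    ∃ (v : HurwitzVector G) (l : ℕ), EntriesIn Γ v ∧ p = frac Γ (cls v) l ∧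
      nielsenVec v = l • nielsenVec (uVec Γ) + nielsenVec v₀ := by
  obtain ⟨x, l, rfl⟩ := exists_eq_frac p
  obtain ⟨v, rfl⟩ := cls_surjective x
  have h := nielsenLoc_frac Γ (cls v) l
  rw [hp, toAdd_ofAdd, nielsen_cls, uCls, nielsen_cls] at h
  have h' : nielsenVec v = l • nielsenVec (uVec Γ) + nielsenVec v₀ := by rw [h]; abel
  refine ⟨v, l, ?_, rfl, h'⟩
  -- The numerator has the type of the `Γ`-word `u_Γ^l v₀`, and a union of classes is recognised by
  -- Nielsen types.
  refine (entriesIn_mul.2 ⟨entriesIn_pow (entriesIn_uVec Γ) l, hv₀⟩).of_nielsenVec_le hΓ ?_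
  rw [h', nielsenVec_mul, nielsenVec_pow]

/-! ### Generating classes in the stable range as elements of the monoid of fractions -/

/-- Equal fractions agree after multiplication by a power of `u_Γ`, which is injective in the stable
range. -/
theorem injOn_toLoc {Γ : Set G} {m : ℕ} (hm : StableFrom Γ m) {v₀ : HurwitzVector G}
    (hv₀ : EntriesIn Γ v₀) (hle : m • nielsenVec (uVec Γ) ≤ nielsenVec v₀) :
    Set.InjOn (toLoc Γ) (genClasses (nielsenVec v₀)) := by
  intro x hx y hy hxy
  obtain ⟨k, hk⟩ := toLoc_eq_iff.1 hxy
  refine (hm v₀ hv₀ hle).2 (uVec Γ ^ k) (entriesIn_pow (entriesIn_uVec Γ) k) hx hy ?_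
  change cls (uVec Γ ^ k) * x = cls (uVec Γ ^ k) * y
  rw [map_pow]
  exact hk

theorem exists_toLoc_eq {Γ : Set G} (hΓ : ∀ a ∈ Γ, ∀ g : G, g⁻¹ * a * g ∈ Γ)
    (hgen : genVec (uVec Γ) = ⊤) {m : ℕ} (hm : StableFrom Γ m) {v₀ : HurwitzVector G}
    (hv₀ : EntriesIn Γ v₀) (hle : m • nielsenVec (uVec Γ) ≤ nielsenVec v₀) {p : Loc Γ}
    (hp : nielsenLoc Γ p = Multiplicative.ofAdd (nielsenVec v₀)) :
    ∃ x ∈ genClasses (nielsenVec v₀), toLoc Γ x = p := by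
  obtain ⟨v, l, -, rfl, hν⟩ := exists_eq_frac_cls hΓ hv₀ hp
  -- The numerator `v` need not generate `G`. One extra factor `u_Γ` repairs this, and stabilisation
  -- then removes `u_Γ^(l + 1)`.
  have hmem : uCls Γ * cls v ∈ genClasses (nielsenVec (uVec Γ ^ (l + 1)) + nielsenVec v₀) := by
    refine ⟨?_, ?_⟩
    · rw [nielsen_mul, uCls, nielsen_cls, nielsen_cls, hν, nielsenVec_pow, succ_nsmul', add_assoc]
    · rw [gen_mul, uCls, gen_cls, hgen, top_sup_eq]
  obtain ⟨y, hy, h⟩ := exists_cls_mul_of_mem_genClasses hΓ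
    (entriesIn_pow (entriesIn_uVec Γ) (l + 1)) (hm v₀ hv₀ hle).1 hmem
  refine ⟨y, hy, eq_frac_iff.2 ?_⟩
  rw [← map_mul, toLoc_eq_iff]
  refine ⟨1, ?_⟩
  rw [pow_one, h, map_pow, (uCls_pow_central Γ l y).eq, ← mul_assoc, ← pow_succ']
  rfl

/-- In the stable range, the generating braid classes of a Nielsen type are identified with the
fractions of this Nielsen type. -/
noncomputable def genClassesEquiv {Γ : Set G} (hΓ : ∀ a ∈ Γ, ∀ g : G, g⁻¹ * a * g ∈ Γ)
    (hgen : genVec (uVec Γ) = ⊤) {m : ℕ} (hm : StableFrom Γ m) {v₀ : HurwitzVector G}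
    (hv₀ : EntriesIn Γ v₀) (hle : m • nielsenVec (uVec Γ) ≤ nielsenVec v₀) :
    genClasses (nielsenVec v₀) ≃
      {p : Loc Γ // nielsenLoc Γ p = Multiplicative.ofAdd (nielsenVec v₀)} :=
  Equiv.ofBijective
    (fun x => ⟨toLoc Γ x.1, by rw [nielsenLoc_toLoc, x.2.1]⟩)
    ⟨fun x y h => Subtype.ext (injOn_toLoc hm hv₀ hle x.2 y.2 (congrArg Subtype.val h)),
      fun p => by
        obtain ⟨x, hx, h⟩ := exists_toLoc_eq hΓ hgen hm hv₀ hle p.2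
        exact ⟨⟨x, hx⟩, Subtype.ext h⟩⟩

theorem coe_genClassesEquiv {Γ : Set G} (hΓ : ∀ a ∈ Γ, ∀ g : G, g⁻¹ * a * g ∈ Γ)
    (hgen : genVec (uVec Γ) = ⊤) {m : ℕ} (hm : StableFrom Γ m) {v₀ : HurwitzVector G}
    (hv₀ : EntriesIn Γ v₀) (hle : m • nielsenVec (uVec Γ) ≤ nielsenVec v₀)
    (x : genClasses (nielsenVec v₀)) :
    (genClassesEquiv hΓ hgen hm hv₀ hle x : Loc Γ) = toLoc Γ x := rfl

/-- Fractions of the Nielsen type of a word `v₀` in `Γ` are the left translates by `v₀` of the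
elements of the kernel of the Nielsen map. -/
noncomputable def kerTranslateEquiv {Γ : Set G} (hΓ : ∀ a ∈ Γ, ∀ g : G, g⁻¹ * a * g ∈ Γ)
    {v₀ : HurwitzVector G} (hv₀ : EntriesIn Γ v₀) {w : Loc Γ}
    (hw : nielsenLoc Γ w = Multiplicative.ofAdd (nielsenVec v₀)) :
    nielsenKer Γ ≃ {p : Loc Γ // nielsenLoc Γ p = Multiplicative.ofAdd (nielsenVec v₀)} :=
  -- The product of `w` with a power of `u_Γ` is a `Γ`-word, hence a unit; as the factors commute,
  -- `w` is a unit.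
  have hu : IsUnit w := by
    obtain ⟨v, l, hv, rfl, -⟩ := exists_eq_frac_cls hΓ hv₀ hw
    have := isUnit_toLoc_cls hΓ hv
    rw [← frac_mul_toLoc Γ (cls v) l,
      (commute_toLoc_uCls_pow (frac Γ (cls v) l) l).isUnit_mul_iff] at this
    exact this.1
  Equiv.ofBijective
    (fun k => ⟨w * k.1, by rw [map_mul, hw, k.2, mul_one]⟩)
    ⟨fun k k' h => Subtype.ext (hu.mul_left_cancel (congrArg Subtype.val h)), fun p => by
      obtain ⟨c, rfl⟩ := hu
      refine ⟨⟨↑c⁻¹ * p.1, ?_⟩, Subtype.ext (Units.mul_inv_cancel_left c p.1)⟩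
      rw [MonoidHom.mem_mker]
      have h := map_mul (nielsenLoc Γ) (c : Loc Γ) (↑c⁻¹ * p.1)
      rw [Units.mul_inv_cancel_left, p.2, hw] at h
      exact (mul_eq_left.1 h.symm)⟩

theorem coe_kerTranslateEquiv {Γ : Set G} (hΓ : ∀ a ∈ Γ, ∀ g : G, g⁻¹ * a * g ∈ Γ)
    {v₀ : HurwitzVector G} (hv₀ : EntriesIn Γ v₀) {w : Loc Γ}
    (hw : nielsenLoc Γ w = Multiplicative.ofAdd (nielsenVec v₀)) (k : nielsenKer Γ) :
    (kerTranslateEquiv hΓ hv₀ hw k : Loc Γ) = w * k := rfl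

/-- Under `genClassesEquiv` the action is right multiplication of fractions. It is free and
transitive because each fraction of type `ν₀` can serve as base point in `kerTranslateEquiv`. -/
theorem exists_mulAction_nielsenKer {Γ : Set G} (hΓ : ∀ a ∈ Γ, ∀ g : G, g⁻¹ * a * g ∈ Γ)
    (hgen : genVec (uVec Γ) = ⊤) {m : ℕ} (hm : StableFrom Γ m) {v₀ : HurwitzVector G}
    (hv₀ : EntriesIn Γ v₀) (hle : m • nielsenVec (uVec Γ) ≤ nielsenVec v₀) :
    ∃ _ : MulAction (nielsenKer Γ)ᵐᵒᵖ (genClasses (nielsenVec v₀)),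
      (∀ (k : nielsenKer Γ) (v : HClass G) (l : ℕ), (k : Loc Γ) = frac Γ v l →
        ∀ w w' : genClasses (nielsenVec v₀), MulOpposite.op k • w = w' ↔
          (w : HClass G) * v = (w' : HClass G) * uCls Γ ^ l) ∧
      ∀ w w' : genClasses (nielsenVec v₀), ∃! k : nielsenKer Γ, MulOpposite.op k • w = w' := by
  let e := genClassesEquiv hΓ hgen hm hv₀ hle
  let act : (nielsenKer Γ)ᵐᵒᵖ → genClasses (nielsenVec v₀) → genClasses (nielsenVec v₀) :=
    fun k w => e.symm (kerTranslateEquiv hΓ hv₀ (e w).2 k.unop)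
  have hact : ∀ k w, (e (act k w) : Loc Γ) = e w * k.unop := fun k w => by
    rw [Equiv.apply_symm_apply, coe_kerTranslateEquiv]
  let A : MulAction (nielsenKer Γ)ᵐᵒᵖ (genClasses (nielsenVec v₀)) :=
    { smul := act
      one_smul := fun w => e.injective <| Subtype.ext <| by
        change (e (act 1 w) : Loc Γ) = _
        rw [hact]
        simp
      mul_smul := fun k k' w => e.injective <| Subtype.ext <| by
        change (e (act (k * k') w) : Loc Γ) = e (act k (act k' w))
        rw [hact, hact, hact]
        simp [mul_assoc] }
  have hiff : ∀ (k : nielsenKer Γ) (w w' : genClasses (nielsenVec v₀)),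
      MulOpposite.op k • w = w' ↔ toLoc Γ w * k = toLoc Γ w' := fun k w w' => by
    rw [← e.injective.eq_iff, Subtype.ext_iff]
    change (e (act _ w) : Loc Γ) = _ ↔ _
    rw [hact]
    rfl
  refine ⟨A, fun k v l hk w w' => ?_, fun w w' => ?_⟩
  · rw [hiff, hk]
    rw [← (isUnit_toLoc_uCls_pow Γ l).mul_left_inj, mul_assoc, frac_mul_toLoc, ← map_mul,
      ← map_mul]
    have hν : nielsen v = l • nielsenVec (uVec Γ) := by
      have h := nielsenLoc_frac Γ v l
      rw [← hk, show nielsenLoc Γ k = 1 from k.2, toAdd_one, uCls, nielsen_cls] at h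
      exact (sub_eq_zero.1 h.symm)
    -- Both sides of the concrete formula are generating classes of type `ν₀ + l ν(u_Γ)`. This is
    -- again in the stable range, so they can be compared as fractions.
    have hv₁ : EntriesIn Γ (v₀ * uVec Γ ^ l) :=
      entriesIn_mul.2 ⟨hv₀, entriesIn_pow (entriesIn_uVec Γ) l⟩
    refine (injOn_toLoc hm hv₁ ?_).eq_iff ⟨?_, ?_⟩ ⟨?_, ?_⟩
    · rw [nielsenVec_mul]
      exact hle.trans (le_add_of_nonneg_right (nielsenVec_nonneg _))
    · rw [nielsen_mul, w.2.1, hν, nielsenVec_mul, nielsenVec_pow]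
    · rw [gen_mul, w.2.2, top_sup_eq]
    · rw [nielsen_mul, w'.2.1, nielsen_pow, uCls, nielsen_cls, nielsenVec_mul, nielsenVec_pow]
    · rw [gen_mul, w'.2.2, top_sup_eq]
  · obtain ⟨k, hk⟩ := (kerTranslateEquiv hΓ hv₀ (e w).2).surjective (e w')
    refine ⟨k, (hiff k w w').2 (congrArg Subtype.val hk), fun k' hk' => ?_⟩
    apply (kerTranslateEquiv hΓ hv₀ (e w).2).injective
    rw [hk]
    exact Subtype.ext ((hiff k' w w').1 hk')

end HurwitzMonoid

namespace HurwitzMonoid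

open scoped commutatorElement

variable {G : Type*} [Group G]

/-- In the central extension `G_Γ → G` a commutator thus depends only on the images of its two
arguments in `G`. -/
theorem commutatorElement_mul_mul_of_central {H : Type*} [Group H] (p q : H) {y z : H}
    (hy : ∀ x, Commute x y) (hz : ∀ x, Commute x z) : ⁅p * y, q * z⁆ = ⁅p, q⁆ := by
  have e₁ : p * y * (q * z) = p * q * (y * z) := by
    rw [mul_assoc, ← mul_assoc y, ← (hy q).eq, mul_assoc, ← mul_assoc p]
  have e₂ : q * z * (p * y) = q * p * (y * z) := by
    rw [mul_assoc, ← mul_assoc z, ← (hz p).eq, mul_assoc, ← mul_assoc q, (hy z).eq]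
  rw [commutatorElement_def, commutatorElement_def, mul_assoc (p * y * (q * z)), ← mul_inv_rev, e₁,
    e₂]
  group

/-! ### The group `G_Γ` -/

/-- The generator of `G_Γ` given by an element of `G`. -/
def hat (Γ : Set G) (g : G) : TautGroup Γ := QuotientGroup.mk (FreeGroup.of g)

theorem hat_mul_hat {Γ : Set G} {a : G} (ha : a ∈ Γ) (b : G) :
    hat Γ a * hat Γ b = hat Γ b * hat Γ (b⁻¹ * a * b) := by
  have h : FreeGroup.of a * FreeGroup.of b * (FreeGroup.of (b⁻¹ * a * b))⁻¹ *
      (FreeGroup.of b)⁻¹ ∈ relSubgroup Γ :=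
    Subgroup.subset_normalClosure (Or.inr ⟨a, ha, b, rfl⟩)
  have h' : hat Γ a * hat Γ b * (hat Γ (b⁻¹ * a * b))⁻¹ * (hat Γ b)⁻¹ = 1 :=
    (QuotientGroup.eq_one_iff _).2 h
  rw [mul_inv_eq_one, mul_inv_eq_iff_eq_mul] at h'
  exact h'

theorem boundary_hat (Γ : Set G) (g : G) : boundary Γ (hat Γ g) = g := by
  simp [boundary, hat, freeProj]

theorem boundary_surjective (Γ : Set G) : Function.Surjective (boundary Γ) :=
  fun g => ⟨hat Γ g, boundary_hat Γ g⟩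

/-- The relations `[F, R]` make the kernel of `G_Γ → G` central. -/
theorem commute_of_boundary_eq_one {Γ : Set G} {t : TautGroup Γ} (ht : boundary Γ t = 1)
    (s : TautGroup Γ) : Commute s t := by
  obtain ⟨r, rfl⟩ := QuotientGroup.mk_surjective t
  obtain ⟨f, rfl⟩ := QuotientGroup.mk_surjective s
  have h : ⁅f, r⁆ ∈ relSubgroup Γ :=
    Subgroup.subset_normalClosure (Or.inl (Subgroup.commutator_mem_commutator (Subgroup.mem_top f) ht))
  have h' : ⁅(f : TautGroup Γ), (r : TautGroup Γ)⁆ = 1 := (QuotientGroup.eq_one_iff _).2 h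
  exact commutatorElement_eq_one_iff_commute.1 h'

/-- The homomorphism from Hurwitz vectors to `G_Γ`. -/
def tautVec (Γ : Set G) : HurwitzVector G →* TautGroup Γ := FreeMonoid.lift (hat Γ)

theorem tautVec_of (Γ : Set G) (g : G) : tautVec Γ (FreeMonoid.of g) = hat Γ g := by
  simp [tautVec]

theorem boundary_tautVec (Γ : Set G) (v : HurwitzVector G) :
    boundary Γ (tautVec Γ v) = evalVec G v := by
  induction v using FreeMonoid.inductionOn' with
  | one => simp
  | of_mul g v ih => rw [map_mul, map_mul, map_mul, tautVec_of, boundary_hat, ih, evalVec_of]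

open Classical in
/-- The homomorphism from Hurwitz vectors to `G_Γ` with a zero adjoined, under which the entries
outside `Γ` go to zero. -/
noncomputable def tautZeroVec (Γ : Set G) : HurwitzVector G →* WithZero (TautGroup Γ) :=
  FreeMonoid.lift fun g => if g ∈ Γ then (hat Γ g : WithZero (TautGroup Γ)) else 0

theorem tautZeroVec_eq {Γ : Set G} {v : HurwitzVector G} (hv : EntriesIn Γ v) :
    tautZeroVec Γ v = (tautVec Γ v : WithZero (TautGroup Γ)) := by
  induction v using FreeMonoid.inductionOn' with
  | one => simp
  | of_mul g v ih =>
    rw [entriesIn_mul, entriesIn_of] at hv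
    rw [map_mul, map_mul, ih hv.2, tautVec_of, WithZero.coe_mul]
    simp [tautZeroVec, hv.1]

/-- The conjugation relation in `G_Γ` is imposed only for `a ∈ Γ`. Sending letters outside `Γ` to
zero gives a map invariant under all moves, even those through words not in `Γ`; closure under
conjugation keeps letters on their side. -/
theorem tautZeroVec_move {Γ : Set G} (hΓ : ∀ a ∈ Γ, ∀ g : G, g⁻¹ * a * g ∈ Γ) (i : ℕ)
    (l : List G) : tautZeroVec Γ (FreeMonoid.ofList (move i l)) =
      tautZeroVec Γ (FreeMonoid.ofList l) := by
  induction i generalizing l with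
  | zero =>
    rcases l with _ | ⟨a, _ | ⟨b, l⟩⟩
    · rfl
    · rfl
    · simp only [move, FreeMonoid.ofList_cons, map_mul, ← mul_assoc]
      congr 1
      have hiff : b⁻¹ * a * b ∈ Γ ↔ a ∈ Γ :=
        ⟨fun h => by simpa [mul_assoc] using hΓ _ h b⁻¹, fun h => hΓ a h b⟩
      by_cases ha : a ∈ Γ
      · simp only [tautZeroVec, FreeMonoid.lift_eval_of, hiff, ha, if_true]
        split_ifs
        · rw [← WithZero.coe_mul, ← WithZero.coe_mul, hat_mul_hat ha]
        · simp
      · simp [tautZeroVec, hiff, ha]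
  | succ n ih =>
    rcases l with _ | ⟨a, l⟩
    · rfl
    · simp only [move, FreeMonoid.ofList_cons, map_mul, ih]

theorem tautVec_eq_of_cls_eq {Γ : Set G} (hΓ : ∀ a ∈ Γ, ∀ g : G, g⁻¹ * a * g ∈ Γ)
    {v w : HurwitzVector G} (hv : EntriesIn Γ v) (hw : EntriesIn Γ w) (h : cls v = cls w) :
    tautVec Γ v = tautVec Γ w := by
  have h' := eq_of_braidEquiv (fun l => tautZeroVec Γ (FreeMonoid.ofList l))
    (tautZeroVec_move hΓ) ((braidCon G).eq.1 h)
  change tautZeroVec Γ v = tautZeroVec Γ w at h'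
  rwa [tautZeroVec_eq hv, tautZeroVec_eq hw, WithZero.coe_inj] at h'

/-- In the abelianisation of `G_Γ`, the image of a word in `Γ` depends only on its Nielsen type. -/
theorem abelianization_tautVec_eq {Γ : Set G} {v w : HurwitzVector G} (hv : EntriesIn Γ v)
    (hw : EntriesIn Γ w) (h : nielsenVec v = nielsenVec w) :
    Abelianization.of (tautVec Γ v) = Abelianization.of (tautVec Γ w) := by
  let L : NielsenGroup G →+ Additive (Abelianization (TautGroup Γ)) :=
    Finsupp.liftAddHom fun C =>
      (zmultiplesHom _) (Additive.ofMul (Abelianization.of (hat Γ (Quotient.out C))))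
  have hL : ∀ v : HurwitzVector G, EntriesIn Γ v →
      L (nielsenVec v) = Additive.ofMul (Abelianization.of (tautVec Γ v)) := by
    intro v hv
    induction v using FreeMonoid.inductionOn' with
    | one => simp [nielsenVec_one]
    | of_mul g v ih =>
      rw [entriesIn_mul, entriesIn_of] at hv
      rw [nielsenVec_mul, map_add, ih hv.2, map_mul, map_mul, ofMul_mul, nielsenVec_of, tautVec_of]
      congr 1
      have hconj : IsConj g (Quotient.out (ConjClasses.mk g)) :=
        ConjClasses.mk_eq_mk_iff_isConj.1 (Quotient.out_eq (ConjClasses.mk g)).symm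
      obtain ⟨c, hc⟩ := isConj_iff.1 hconj
      -- The defining relation with `b = c⁻¹`: conjugate generators from `Γ` agree in the
      -- abelianisation.
      have h := congrArg (Abelianization.of : TautGroup Γ →* _) (hat_mul_hat hv.1 c⁻¹)
      rw [inv_inv, hc, map_mul, map_mul, mul_comm] at h
      simp only [L, Finsupp.liftAddHom_apply_single, zmultiplesHom_apply, one_smul]
      rw [mul_left_cancel h]
  exact Additive.ofMul.injective ((hL v hv).symm.trans ((congrArg L h).trans (hL w hw)))

/-! ### The commutator subgroup of `G_Γ` as an extension of `[G, G]` by `H_{2,Γ}`. -/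

theorem mem_H2_iff {Γ : Set G} {t : TautGroup Γ} :
    t ∈ H2 Γ ↔ boundary Γ t = 1 ∧ t ∈ commutator (TautGroup Γ) := by
  rw [H2, MonoidHom.mem_ker, MonoidHom.prod_apply, Prod.mk_eq_one, ← MonoidHom.mem_ker,
    ← MonoidHom.mem_ker, Abelianization.ker_of, MonoidHom.mem_ker]

/-- Surjectivity of `G_Γ → G` passes to commutator subgroups, and `H_{2,Γ}` is the kernel there;
nonempty fibres are its translates. -/
theorem card_fiber_boundary (Γ : Set G) {g : G} (hg : g ∈ commutator G) :
    Nat.card {t : commutator (TautGroup Γ) // boundary Γ t = g} = Nat.card (H2 Γ) := by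
  have hmap : (commutator (TautGroup Γ)).map (boundary Γ) = commutator G := by
    rw [commutator_def, Subgroup.map_commutator, ← MonoidHom.range_eq_map,
      MonoidHom.range_eq_top.2 (boundary_surjective Γ), commutator_def]
  rw [← hmap] at hg
  obtain ⟨s, hs, rfl⟩ := hg
  refine (Nat.card_congr ?_).symm
  exact
    { toFun := fun t => ⟨⟨s * t.1, mul_mem hs (mem_H2_iff.1 t.2).2⟩, by
        simp [(mem_H2_iff.1 t.2).1]⟩
      invFun := fun t => ⟨s⁻¹ * t.1.1, mem_H2_iff.2
        ⟨by simp [t.2], mul_mem (inv_mem hs) t.1.2⟩⟩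
      left_inv := fun t => by simp
      right_inv := fun t => by simp }

theorem boundary_mem_commutator {Γ : Set G} {t : TautGroup Γ}
    (ht : t ∈ commutator (TautGroup Γ)) : boundary Γ t ∈ commutator G := by
  rw [commutator_def] at ht ⊢
  have := Subgroup.mem_map_of_mem (boundary Γ) ht
  rw [Subgroup.map_commutator] at this
  exact Subgroup.commutator_mono le_top le_top this

section Finite

variable [Finite G]

/-- Schur's theorem: modulo central factors every element is some `ĝ`, so there are finitely many
commutators, and these generate a finite group. -/
instance finite_commutator_tautGroup (Γ : Set G) : Finite (commutator (TautGroup Γ)) := by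
  have hfin : (commutatorSet (TautGroup Γ)).Finite := by
    refine (Set.finite_range fun p : G × G => ⁅hat Γ p.1, hat Γ p.2⁆).subset ?_
    rintro _ ⟨s, t, rfl⟩
    refine ⟨(boundary Γ s, boundary Γ t), ?_⟩
    have key : ∀ t : TautGroup Γ, ∃ z, (∀ x, Commute x z) ∧ t = hat Γ (boundary Γ t) * z :=
      fun t => ⟨(hat Γ (boundary Γ t))⁻¹ * t, commute_of_boundary_eq_one (by
        rw [map_mul, map_inv, boundary_hat, inv_mul_cancel]), by group⟩
    obtain ⟨y, hy, hs⟩ := key s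
    obtain ⟨z, hz, ht⟩ := key t
    change ⁅hat Γ (boundary Γ s), hat Γ (boundary Γ t)⁆ = ⁅s, t⁆
    rw [← commutatorElement_mul_mul_of_central _ _ hy hz, ← hs, ← ht]
  have : Finite (commutatorSet (TautGroup Γ)) := hfin
  infer_instance

theorem finite_H2 (Γ : Set G) : Finite (H2 Γ) :=
  Finite.of_injective (β := commutator (TautGroup Γ))
    (fun t => ⟨t.1, (mem_H2_iff.1 t.2).2⟩)
    fun _ _ h => Subtype.ext (by simpa using h)

theorem card_commutator_tautGroup (Γ : Set G) :
    Nat.card (commutator (TautGroup Γ)) = Nat.card (H2 Γ) * Nat.card (commutator G) := by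
  have e : commutator (TautGroup Γ) ≃
      Σ g : commutator G, {t : commutator (TautGroup Γ) // boundary Γ t = g} :=
    { toFun := fun t => ⟨⟨boundary Γ t, boundary_mem_commutator t.2⟩, t, rfl⟩
      invFun := fun p => p.2.1
      left_inv := fun t => rfl
      right_inv := by
        rintro ⟨⟨g, hg⟩, t, ht⟩
        change boundary Γ t = g at ht
        subst ht
        rfl }
  have := Fintype.ofFinite (commutator G)
  rw [Nat.card_congr e, Nat.card_sigma, Finset.sum_congr rfl
    fun g _ => card_fiber_boundary Γ g.2, Finset.sum_const, Finset.card_univ, smul_eq_mul,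
    mul_comm, Nat.card_eq_fintype_card (α := commutator G)]

end Finite

end HurwitzMonoid

namespace HurwitzMonoid

open scoped commutatorElement

variable {G : Type*} [Group G] [Finite G]

/-! ### Comparison of `G_Γ` with the monoid of fractions -/

/-- Inverses are obtained from complements, since powers of `u_Γ` evaluate to `1`. -/
theorem exists_entriesIn_evalVec_eq {Γ : Set G} (hΓ : ∀ a ∈ Γ, ∀ g : G, g⁻¹ * a * g ∈ Γ)
    (hgen : genVec (uVec Γ) = ⊤) (b : G) :
    ∃ v : HurwitzVector G, EntriesIn Γ v ∧ evalVec G v = b := by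
  have hb : b ∈ genVec (uVec Γ) := by rw [hgen]; trivial
  induction hb using Subgroup.closure_induction with
  | mem b hb => exact ⟨FreeMonoid.of b, entriesIn_of.2 (mem_uVec.1 hb), evalVec_of b⟩
  | one => exact ⟨1, entriesIn_one Γ, map_one _⟩
  | mul a b _ _ iha ihb =>
    obtain ⟨v, hv, rfl⟩ := iha
    obtain ⟨w, hw, rfl⟩ := ihb
    exact ⟨v * w, entriesIn_mul.2 ⟨hv, hw⟩, map_mul _ _ _⟩
  | inv a _ ih =>
    obtain ⟨v, hv, rfl⟩ := ih
    obtain ⟨w, N, hw, h⟩ := exists_mul_eq_uCls_pow hΓ hv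
    refine ⟨w, hw, eq_inv_of_mul_eq_one_right ?_⟩
    have h' := congrArg (ev G) h
    rwa [map_mul, map_pow, ev_uCls, one_pow, ev_cls, ev_cls] at h'

/-- Send `b̂` to a `Γ`-word of evaluation `b`. Elements of `R` acquire trivial evaluation and become
central, so `[F, R]` dies; the other relations hold because a letter crossing a word is conjugated
by its evaluation. -/
theorem exists_tautGroup_hom {Γ : Set G} (hΓ : ∀ a ∈ Γ, ∀ g : G, g⁻¹ * a * g ∈ Γ)
    (hgen : genVec (uVec Γ) = ⊤) :
    ∃ φ : TautGroup Γ →* (Loc Γ)ˣ,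
      (∀ v, EntriesIn Γ v → (φ (tautVec Γ v) : Loc Γ) = toLoc Γ (cls v)) ∧
      ∀ t, evLoc Γ (φ t) = boundary Γ t := by
  have hrep : ∀ b : G, ∃ v : HurwitzVector G, EntriesIn Γ v ∧ evalVec G v = b ∧
      -- This choice makes the homomorphism agree with the braid class on `Γ`-words.
      (b ∈ Γ → v = FreeMonoid.of b) := by
    intro b
    by_cases hb : b ∈ Γ
    · exact ⟨FreeMonoid.of b, entriesIn_of.2 hb, evalVec_of b, fun _ => rfl⟩
    · obtain ⟨v, hv, h⟩ := exists_entriesIn_evalVec_eq hΓ hgen b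
      exact ⟨v, hv, h, fun h => absurd h hb⟩
  choose r hrΓ hrev hrof using hrep
  choose s hs using fun b => isUnit_toLoc_cls hΓ (hrΓ b)
  let φ₀ : FreeGroup G →* (Loc Γ)ˣ := FreeGroup.lift s
  have hev : ∀ f : FreeGroup G, evLoc Γ (φ₀ f) = freeProj G f := by
    have h : (Units.map (evLoc Γ)).comp φ₀ = toUnits.toMonoidHom.comp (freeProj G) := by
      ext b
      simp [φ₀, freeProj, hs, evLoc_toLoc, ev_cls, hrev]
    exact fun f => congrArg Units.val (DFunLike.congr_fun h f)
  have hker : relSubgroup Γ ≤ φ₀.ker := by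
    refine Subgroup.normalClosure_le_normal ?_
    rintro x (hx | ⟨a, ha, b, rfl⟩)
    · refine Subgroup.commutator_le.2 (fun f _ r hr => ?_) hx
      rw [MonoidHom.mem_ker, map_commutatorElement, commutatorElement_eq_one_iff_commute]
      have h : evLoc Γ (φ₀ r) = 1 := (hev r).trans hr
      exact Units.ext (commute_of_evLoc_eq_one h (φ₀ f : Loc Γ)).eq
    · change φ₀ _ = 1
      simp only [map_mul, map_inv, φ₀, FreeGroup.lift_apply_of]
      rw [mul_inv_eq_one, mul_inv_eq_iff_eq_mul]
      ext
      have hsΓ : ∀ {c : G}, c ∈ Γ → (s c : Loc Γ) = toLoc Γ (single c) := fun {c} hc => by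
        rw [hs, hrof c hc]
        rfl
      have h := single_mul a (cls (r b))
      rw [ev_cls, hrev] at h
      rw [Units.val_mul, Units.val_mul, hsΓ ha, hsΓ (hΓ a ha b), hs, ← map_mul, ← map_mul, h]
  refine ⟨QuotientGroup.lift (relSubgroup Γ) φ₀ hker, fun v hv => ?_, fun t => ?_⟩
  · induction v using FreeMonoid.inductionOn' with
    | one => simp
    | of_mul g v ih =>
      rw [entriesIn_mul, entriesIn_of] at hv
      rw [map_mul, map_mul, Units.val_mul, ih hv.2, map_mul, map_mul, tautVec_of]
      congr 1
      rw [← hrof g hv.1, ← hs]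
      simp [hat, φ₀]
  · obtain ⟨f, rfl⟩ := QuotientGroup.mk_surjective t
    exact hev f

/-! ### Elements of the commutator subgroup of `G_Γ` as fractions of `Γ`-words. -/

theorem commute_tautVec_uVec_pow (Γ : Set G) (l : ℕ) (t : TautGroup Γ) :
    Commute t (tautVec Γ (uVec Γ ^ l)) :=
  commute_of_boundary_eq_one (by
    rw [boundary_tautVec, map_pow, evalVec_uVec, one_pow]) t

theorem exists_mul_tautVec_eq {Γ : Set G} (hΓ : ∀ a ∈ Γ, ∀ g : G, g⁻¹ * a * g ∈ Γ)
    {t : TautGroup Γ} (ht : t ∈ Subgroup.closure (tautVec Γ '' {v | EntriesIn Γ v})) :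
    ∃ (v : HurwitzVector G) (l : ℕ), EntriesIn Γ v ∧
      t * tautVec Γ (uVec Γ ^ l) = tautVec Γ v := by
  induction ht using Subgroup.closure_induction with
  | mem t ht =>
    obtain ⟨v, hv, rfl⟩ := ht
    exact ⟨v, 0, hv, by simp⟩
  | one => exact ⟨1, 0, entriesIn_one Γ, by simp⟩
  | mul s t _ _ ihs iht =>
    obtain ⟨v, k, hv, h₁⟩ := ihs
    obtain ⟨w, l, hw, h₂⟩ := iht
    refine ⟨v * w, k + l, entriesIn_mul.2 ⟨hv, hw⟩, ?_⟩
    rw [map_mul, ← h₁, ← h₂, pow_add, map_mul, mul_assoc, mul_assoc, ← mul_assoc t,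
      (commute_tautVec_uVec_pow Γ k t).eq, mul_assoc]
  | inv t _ ih =>
    obtain ⟨v, l, hv, h₁⟩ := ih
    obtain ⟨w, N, hw, h₂⟩ := exists_mul_eq_uCls_pow hΓ hv
    have hu := entriesIn_uVec Γ
    have h₃ : tautVec Γ (v * w) = tautVec Γ (uVec Γ ^ N) :=
      tautVec_eq_of_cls_eq hΓ (entriesIn_mul.2 ⟨hv, hw⟩) (entriesIn_pow hu N) (by
        rw [map_mul, map_pow, h₂]
        rfl)
    refine ⟨uVec Γ ^ l * w, N, entriesIn_mul.2 ⟨entriesIn_pow hu l, hw⟩, ?_⟩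
    rw [← h₃, map_mul, map_mul, ← h₁, inv_mul_eq_iff_eq_mul, mul_assoc]

/-- Every element of `G_Γ` is a `Γ`-word times a central factor, and commutators do not see the
latter. So generators `b̂` with `b ∉ Γ` are not needed here. -/
theorem commutator_tautGroup_le {Γ : Set G} (hΓ : ∀ a ∈ Γ, ∀ g : G, g⁻¹ * a * g ∈ Γ)
    (hgen : genVec (uVec Γ) = ⊤) : commutator (TautGroup Γ) ≤
      Subgroup.closure (tautVec Γ '' {v | EntriesIn Γ v}) := by
  have key : ∀ t : TautGroup Γ, ∃ v, EntriesIn Γ v ∧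
      ∃ z, (∀ x, Commute x z) ∧ t = tautVec Γ v * z := by
    intro t
    obtain ⟨v, hv, h⟩ := exists_entriesIn_evalVec_eq hΓ hgen (boundary Γ t)
    exact ⟨v, hv, (tautVec Γ v)⁻¹ * t, commute_of_boundary_eq_one (by
      rw [map_mul, map_inv, boundary_tautVec, h, inv_mul_cancel]), by group⟩
  rw [commutator_def, Subgroup.commutator_le]
  intro s _ t _
  obtain ⟨v, hv, y, hy, rfl⟩ := key s
  obtain ⟨w, hw, z, hz, rfl⟩ := key t
  rw [commutatorElement_mul_mul_of_central _ _ hy hz, commutatorElement_def]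
  have hv' : tautVec Γ v ∈ Subgroup.closure (tautVec Γ '' {v | EntriesIn Γ v}) :=
    Subgroup.subset_closure ⟨v, hv, rfl⟩
  have hw' : tautVec Γ w ∈ Subgroup.closure (tautVec Γ '' {v | EntriesIn Γ v}) :=
    Subgroup.subset_closure ⟨w, hw, rfl⟩
  exact mul_mem (mul_mem (mul_mem hv' hw') (inv_mem hv')) (inv_mem hw')

/-- The kernel of the Nielsen map on the monoid of fractions is the commutator subgroup of
`G_Γ`. -/
theorem exists_commutator_equiv {Γ : Set G} (hΓ : ∀ a ∈ Γ, ∀ g : G, g⁻¹ * a * g ∈ Γ)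
    (hgen : genVec (uVec Γ) = ⊤) :
    ∃ e : commutator (TautGroup Γ) ≃ nielsenKer Γ, ∀ t, evLoc Γ (e t) = boundary Γ t := by
  obtain ⟨φ, hφ, hev⟩ := exists_tautGroup_hom hΓ hgen
  have hu := entriesIn_uVec Γ
  have hmem : ∀ t ∈ commutator (TautGroup Γ), (φ t : Loc Γ) ∈ nielsenKer Γ := by
    intro t ht
    exact Abelianization.commutator_subset_ker
      (((nielsenLoc Γ).comp (Units.coeHom (Loc Γ))).comp φ) ht
  refine ⟨Equiv.ofBijective (fun t => ⟨φ t.1, hmem t.1 t.2⟩) ⟨?_, ?_⟩, fun t => hev t⟩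
  -- Injectivity: write `t = v / u_Γ^l`. If its image is `1`, then `v` and `u_Γ^l` have the same
  -- class up to a power of `u_Γ`, hence the same image in `G_Γ`.
  · have hone : ∀ t ∈ commutator (TautGroup Γ), φ t = 1 → t = 1 := by
      intro t ht h
      obtain ⟨v, l, hv, htv⟩ := exists_mul_tautVec_eq hΓ (commutator_tautGroup_le hΓ hgen ht)
      have h₁ := hφ v hv
      rw [← htv, map_mul, h, one_mul, hφ _ (entriesIn_pow hu l)] at h₁
      obtain ⟨k, hk⟩ := toLoc_eq_iff.1 h₁
      have h₂ : tautVec Γ (uVec Γ ^ k * uVec Γ ^ l) = tautVec Γ (uVec Γ ^ k * v) :=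
        tautVec_eq_of_cls_eq hΓ (entriesIn_mul.2 ⟨entriesIn_pow hu k, entriesIn_pow hu l⟩)
          (entriesIn_mul.2 ⟨entriesIn_pow hu k, hv⟩) (by
            rw [map_mul, map_mul, map_pow]
            rw [map_pow] at hk
            exact hk)
      rw [map_mul, map_mul] at h₂
      exact mul_eq_right.1 (htv.trans (mul_left_cancel h₂).symm)
    intro s t hst
    have hst' : φ s = φ t := Units.ext (congrArg Subtype.val hst)
    exact Subtype.ext (mul_inv_eq_one.1 (hone _ (mul_mem s.2 (inv_mem t.2)) (by
      rw [map_mul, map_inv, hst', mul_inv_cancel])))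
  -- Surjectivity: an element of the kernel is `v / u_Γ^l` with `ν(v) = l ν(u_Γ)`, so its lift to
  -- `G_Γ` vanishes in the abelianisation.
  · rintro ⟨k, hk⟩
    obtain ⟨v, l, hv, rfl, hν⟩ := exists_eq_frac_cls hΓ (entriesIn_one Γ)
      (p := k) (by rw [nielsenVec_one]; exact hk)
    have hl := entriesIn_pow hu l
    refine ⟨⟨tautVec Γ v * (tautVec Γ (uVec Γ ^ l))⁻¹, ?_⟩, Subtype.ext (eq_frac_iff.2 ?_)⟩
    · rw [← Abelianization.ker_of, MonoidHom.mem_ker, map_mul, map_inv, mul_inv_eq_one]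
      refine abelianization_tautVec_eq hv hl ?_
      rw [hν, nielsenVec_one, add_zero, nielsenVec_pow]
    · have h := hφ (uVec Γ ^ l) hl
      rw [map_pow cls] at h
      change (φ _ : Loc Γ) * toLoc Γ (cls (uVec Γ) ^ l) = _
      rw [← h, ← Units.val_mul, ← map_mul, inv_mul_cancel_right, hφ v hv]

/-- In the stable range, the generating classes of a Nielsen type are parametrised by the
commutator subgroup of `G_Γ`. -/
theorem exists_genClasses_equiv {Γ : Set G} (hΓ : ∀ a ∈ Γ, ∀ g : G, g⁻¹ * a * g ∈ Γ)
    (hgen : genVec (uVec Γ) = ⊤) {m : ℕ} (hm : StableFrom Γ m) {v₀ : HurwitzVector G}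
    (hv₀ : EntriesIn Γ v₀) (hle : m • nielsenVec (uVec Γ) ≤ nielsenVec v₀) :
    ∃ e : commutator (TautGroup Γ) ≃ genClasses (nielsenVec v₀),
      ∀ t, ev G (e t) = evalVec G v₀ * boundary Γ t := by
  obtain ⟨e, he⟩ := exists_commutator_equiv hΓ hgen
  have hw : nielsenLoc Γ (toLoc Γ (cls v₀)) = Multiplicative.ofAdd (nielsenVec v₀) := by
    rw [nielsenLoc_toLoc, nielsen_cls]
  refine ⟨(e.trans (kerTranslateEquiv hΓ hv₀ hw)).trans
    (genClassesEquiv hΓ hgen hm hv₀ hle).symm, fun t => ?_⟩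
  rw [← evLoc_toLoc (Γ := Γ), ← coe_genClassesEquiv hΓ hgen hm hv₀ hle, Equiv.trans_apply,
    Equiv.apply_symm_apply, Equiv.trans_apply, coe_kerTranslateEquiv, map_mul, evLoc_toLoc, he,
    ev_cls]

end HurwitzMonoid

theorem mainTheorem2 {G : Type*} [Group G] [Finite G] :
    ∃ m : ℕ, ∀ Γ : Set G, (∀ a ∈ Γ, ∀ g : G, g⁻¹ * a * g ∈ Γ) → genVec (uVec Γ) = ⊤ →
      Finite (H2 Γ) ∧
      ∀ ν₀ : NielsenGroup G,
        ν₀ ∈ nielsenVec '' {v : HurwitzVector G | ∀ g ∈ v.toList, g ∈ Γ} →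
        m • nielsenVec (uVec Γ) ≤ ν₀ →
        -- the number of classes
        Nat.card (genClasses ν₀) = Nat.card (H2 Γ) * Nat.card (commutator G) ∧
        -- the evaluations that occur, and the number of classes with given evaluation
        (∀ v₀ : HurwitzVector G, nielsenVec v₀ = ν₀ →
          (∀ x ∈ genClasses ν₀, (evalVec G v₀)⁻¹ * ev G x ∈ commutator G) ∧
          ∀ g : G, (evalVec G v₀)⁻¹ * g ∈ commutator G →
            Nat.card {x : HClass G | x ∈ genClasses ν₀ ∧ ev G x = g} = Nat.card (H2 Γ)) ∧
        -- the free and transitive action of the kernel of the Nielsen map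
        ∃ _ : MulAction (nielsenKer Γ)ᵐᵒᵖ (genClasses ν₀),
          (∀ (k : nielsenKer Γ) (v : HClass G) (l : ℕ), (k : Loc Γ) = frac Γ v l →
            ∀ w w' : genClasses ν₀, MulOpposite.op k • w = w' ↔
              (w : HClass G) * v = (w' : HClass G) * uCls Γ ^ l) ∧
          ∀ w w' : genClasses ν₀, ∃! k : nielsenKer Γ, MulOpposite.op k • w = w' := by
  obtain ⟨m, hm⟩ := exists_forall_stableFrom G
  refine ⟨m, fun Γ hΓ hgen => ⟨finite_H2 Γ, ?_⟩⟩
  rintro _ ⟨v₁, hv₁, rfl⟩ hle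
  refine ⟨?_, fun v₀ hv₀ => ?_, exists_mulAction_nielsenKer hΓ hgen (hm Γ hΓ) hv₁ hle⟩
  · obtain ⟨e, -⟩ := exists_genClasses_equiv hΓ hgen (hm Γ hΓ) hv₁ hle
    rw [← Nat.card_congr e, card_commutator_tautGroup]
  -- The type forces `v₀` to be a `Γ`-word, so it can replace `v₁` as the base point from which
  -- evaluations are measured.
  · have hΓ₀ : EntriesIn Γ v₀ := EntriesIn.of_nielsenVec_le hΓ hv₁ hv₀.le
    rw [← hv₀] at hle ⊢
    obtain ⟨e, he⟩ := exists_genClasses_equiv hΓ hgen (hm Γ hΓ) hΓ₀ hle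
    refine ⟨fun x hx => ?_, fun g hg => ?_⟩
    · obtain ⟨t, ht⟩ := e.surjective ⟨x, hx⟩
      have h := he t
      rw [ht] at h
      rw [h, inv_mul_cancel_left]
      exact boundary_mem_commutator t.2
    · rw [← card_fiber_boundary Γ hg]
      refine (Nat.card_congr ?_).symm
      exact (e.subtypeEquiv fun t => by rw [he, eq_inv_mul_iff_mul_eq]).trans
        (Equiv.subtypeSubtypeEquivSubtypeInter (· ∈ genClasses (nielsenVec v₀))
          fun x => ev G x = g)
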